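/- **Common Matching Weight.** An instance consists of two complete bipartite graphs $G_1=(V_1\cup W_1,E_1,w_1)$ and $G_2=(V_2\cup W_2,E_2,w_2)$ with $|V_1|=|W_1|$, $|V_2|=|W_2|$ and nonnegative integer edge weights; it is a YES-instance if there are perfect matchings $M_1$ of $G_1$ and $M_2$ of $G_2$ with $w_1(M_1)=w_2(M_2)$, where the weight of a matching is the sum of the weights of its edges. **Channel Assignment.** An instance $(V,d,s)$ consists of a finite set $V$ of vertices, a symmetric function $d:V^2\to\mathbb{N}=\{0,1,2,\dots\}$ with $d(x,x)=0$ for all $x\in V$ (the edge weights), and $s\in\mathbb{N}$; it is a YES-instance if there is $c:V\to\mathbb{Z}$ with $|c(x)-c(y)|\ge d(x,y)$ for all $x,y\in V$ and with span $\max_{v\in V}c(v)-\min_{v\in V}c(v)+1\le s$ (the span is $0$ if $V=\emptyset$). Instances are encoded as strings by listing the entries of the weight matrices (for Channel Assignment, also $s$) in binary. **Statement.** There are a function $f$, computable in polynomial time, from instances of Common Matching Weight to instances of Channel Assignment, and an absolute constant $C$, such that for every instance $I=(G_1,G_2)$ of Common Matching Weight, with $n_1=|V(G_1)|$ and $n_2=|V(G_2)|$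 vertices, the instance $f(I)=(V,d,s)$ has the following properties: 1. $f(I)$ is a YES-instance if and only if $I$ is a YES-instance, that is, if and only if there are perfect matchings of $G_1$ and $G_2$ of equal weight; 2. $|V|\le C\,(n_1+n_2)$; 3. whenever all weights of $G_1$ are at most $m_1$ and all weights of $G_2$ are at most $m_2$, where $m_1,m_2\in\mathbb{N}$, we have $\max_{x,y\in V}d(x,y)\le C\,(n_1^2m_1+n_2^2m_2)$ (with maximum $0$ if $V=\emptyset$). -/

import Mathlib

/-! ## Common Matching Weight -/

/-- A complete bipartite graph with two sides of the same size `k` (numbered `0, …, k - 1` each)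
and nonnegative integer edge weights; `w i j` is the weight of the edge between vertex `i` of the
first side and vertex `j` of the second side. -/
structure WeightedBipartite where
  k : ℕ
  w : Fin k → Fin k → ℕ

namespace WeightedBipartite

/-- The underlying complete bipartite graph. -/
abbrev graph (G : WeightedBipartite) : SimpleGraph (Fin G.k ⊕ Fin G.k) :=
  completeBipartiteGraph (Fin G.k) (Fin G.k)

/-- The number of vertices, counting both sides. -/
def numVertices (G : WeightedBipartite) : ℕ := Fintype.card (Fin G.k ⊕ Fin G.k)

open scoped Classical in
/-- The total weight of the edges of a subgraph. -/
noncomputable def weight (G : WeightedBipartite) (M : G.graph.Subgraph) : ℕ :=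
  ∑ e : Fin G.k × Fin G.k with M.Adj (Sum.inl e.1) (Sum.inr e.2), G.w e.1 e.2

/-- All edge weights are at most `m`. -/
def BoundedBy (G : WeightedBipartite) (m : ℕ) : Prop := ∀ i j, G.w i j ≤ m

end WeightedBipartite

/-- An instance of Common Matching Weight. -/
structure CommonMatchingWeight where
  G₁ : WeightedBipartite
  G₂ : WeightedBipartite

/-- YES-instance: there are perfect matchings of equal weight in the two graphs. -/
def CommonMatchingWeight.IsYes (I : CommonMatchingWeight) : Prop :=
  ∃ (M₁ : I.G₁.graph.Subgraph) (M₂ : I.G₂.graph.Subgraph),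
    M₁.IsPerfectMatching ∧ M₂.IsPerfectMatching ∧ I.G₁.weight M₁ = I.G₂.weight M₂

/-! ## Channel Assignment -/

/-- An instance `(V, d, s)` of (the decision version of) Channel Assignment: vertex set
`V = {0, …, n - 1}`, a symmetric weight function `d` (without loops), and the allowed span `s`. -/
structure ChannelAssignment where
  n : ℕ
  d : Fin n → Fin n → ℕ
  d_symm : ∀ x y, d x y = d y x
  d_self : ∀ x, d x x = 0
  s : ℕ

namespace ChannelAssignment

/-- An assignment `c` is proper if `|c x - c y| ≥ d x y` for all `x`, `y`. -/
def IsProper (I : ChannelAssignment) (c : Fin I.n → ℤ) : Prop :=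
  ∀ x y, (I.d x y : ℤ) ≤ |c x - c y|

/-- The span `max c - min c + 1` of an assignment; it is `0` if there are no vertices. -/
def span {n : ℕ} (c : Fin n → ℤ) : ℤ :=
  if h : (Finset.univ : Finset (Fin n)).Nonempty then
    Finset.univ.sup' h c - Finset.univ.inf' h c + 1
  else 0

/-- YES-instance: there is a proper assignment of span at most `s`. -/
def IsYes (I : ChannelAssignment) : Prop :=
  ∃ c : Fin I.n → ℤ, I.IsProper c ∧ span c ≤ I.s

end ChannelAssignment

/-! ## Encodings of the instances as strings over a finite alphabet

Numbers are written in binary; matrices are written row by row. -/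

namespace InstanceEncoding

open Computability

/-- A number: its binary digits, followed by a comma. -/
def encodeNumber (a : ℕ) : List Γ' := (encodeNat a).map Γ'.bit ++ [Γ'.comma]

/-- A row: its entries between brackets. -/
def encodeRow (r : List ℕ) : List Γ' := Γ'.bra :: (r.flatMap encodeNumber ++ [Γ'.ket])

/-- A list of rows between brackets. -/
def encodeRows (l : List (List ℕ)) : List Γ' := Γ'.bra :: (l.flatMap encodeRow ++ [Γ'.ket])

/-- A square matrix, row by row. -/
def encodeMatrix {n : ℕ} (A : Fin n → Fin n → ℕ) : List Γ' :=
  encodeRows (List.ofFn fun i => List.ofFn fun j => A i j)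

theorem encodeNumber_append_inj {a b : ℕ} {t u : List Γ'}
    (h : encodeNumber a ++ t = encodeNumber b ++ u) : a = b ∧ t = u := by
  have key : ∀ (p q : List Bool), p.map Γ'.bit ++ Γ'.comma :: t = q.map Γ'.bit ++ Γ'.comma :: u →
      p = q ∧ t = u := by
    intro p
    induction p with
    | nil => intro q hq; cases q <;> simp_all
    | cons x p ih =>
      intro q hq
      cases q with
      | nil => simp at hq
      | cons y q =>
        simp only [List.map_cons, List.cons_append, List.cons.injEq, Γ'.bit.injEq] at hq
        obtain ⟨h1, h2⟩ := ih q hq.2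
        exact ⟨by rw [hq.1, h1], h2⟩
  obtain ⟨h1, h2⟩ := key (encodeNat a) (encodeNat b) (by simpa [encodeNumber] using h)
  refine ⟨?_, h2⟩
  rw [← decode_encodeNat a, h1, decode_encodeNat]

/-- Bracketed concatenations of codes can be decoded, if the codes of the items can be and do not
begin with a closing bracket. -/
theorem flatMap_ket_inj {α : Type} {e : α → List Γ'}
    (he : ∀ {a b : α} {t u : List Γ'}, e a ++ t = e b ++ u → a = b ∧ t = u)
    (hk : ∀ (a : α) (t u : List Γ'), e a ++ t ≠ Γ'.ket :: u) {p q : List α} {t u : List Γ'}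
    (h : p.flatMap e ++ Γ'.ket :: t = q.flatMap e ++ Γ'.ket :: u) : p = q ∧ t = u := by
  induction p generalizing q with
  | nil =>
    cases q with
    | nil => simpa using h
    | cons b q =>
      simp only [List.flatMap_nil, List.nil_append, List.flatMap_cons, List.append_assoc] at h
      exact absurd h.symm (hk _ _ _)
  | cons a p ih =>
    cases q with
    | nil =>
      simp only [List.flatMap_nil, List.nil_append, List.flatMap_cons, List.append_assoc] at h
      exact absurd h (hk _ _ _)
    | cons b q =>
      simp only [List.flatMap_cons, List.append_assoc] at h
      obtain ⟨h1, h2⟩ := he h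
      obtain ⟨h3, h4⟩ := ih h2
      exact ⟨by rw [h1, h3], h4⟩

theorem encodeRow_append_inj {p q : List ℕ} {t u : List Γ'}
    (h : encodeRow p ++ t = encodeRow q ++ u) : p = q ∧ t = u := by
  refine flatMap_ket_inj (e := encodeNumber) encodeNumber_append_inj ?_
    (by simpa [encodeRow] using h)
  intro a t u
  unfold encodeNumber
  cases encodeNat a <;> simp

theorem encodeMatrix_append_inj {n m : ℕ} {A : Fin n → Fin n → ℕ} {B : Fin m → Fin m → ℕ}
    {t u : List Γ'} (h : encodeMatrix A ++ t = encodeMatrix B ++ u) :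
    n = m ∧ A ≍ B ∧ t = u := by
  obtain ⟨h1, h2⟩ := flatMap_ket_inj (e := encodeRow) encodeRow_append_inj
    (by intro a t u; simp [encodeRow]) (by simpa [encodeMatrix, encodeRows] using h)
  have hn : n = m := by simpa using congrArg List.length h1
  subst hn
  refine ⟨rfl, heq_of_eq ?_, h2⟩
  funext i j
  exact congrFun (List.ofFn_injective (congrFun (List.ofFn_injective h1) i)) j

end InstanceEncoding

open InstanceEncoding in
/-- The two weight matrices, one after the other. -/
def CommonMatchingWeight.encode (I : CommonMatchingWeight) : List Computability.Γ' :=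
  encodeMatrix I.G₁.w ++ encodeMatrix I.G₂.w

open InstanceEncoding in
/-- The weight matrix, followed by the allowed span. -/
def ChannelAssignment.encode (I : ChannelAssignment) : List Computability.Γ' :=
  encodeMatrix I.d ++ encodeNumber I.s

open InstanceEncoding in
theorem CommonMatchingWeight.encode_injective : Function.Injective CommonMatchingWeight.encode := by
  rintro ⟨⟨k₁, w₁⟩, ⟨k₂, w₂⟩⟩ ⟨⟨l₁, v₁⟩, ⟨l₂, v₂⟩⟩ h
  obtain ⟨rfl, h1, h⟩ := encodeMatrix_append_inj h
  obtain ⟨rfl, h2, -⟩ := encodeMatrix_append_inj (t := []) (u := []) (by simpa using h)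
  obtain rfl := eq_of_heq h1
  obtain rfl := eq_of_heq h2
  rfl

open InstanceEncoding in
theorem ChannelAssignment.encode_injective : Function.Injective ChannelAssignment.encode := by
  rintro ⟨n, d, hd, hd', s⟩ ⟨m, e, he, he', r⟩ h
  obtain ⟨rfl, h1, h⟩ := encodeMatrix_append_inj h
  obtain ⟨rfl, -⟩ := encodeNumber_append_inj (t := []) (u := []) (by simpa using h)
  obtain rfl := eq_of_heq h1
  rfl

/-! ## A structured language for stack machines, and its compilation to `TM2` -/

namespace StackProg

open Computability Turing

/-- The stacks: a main stack, two storage stacks, a transfer stack and a counter stack. -/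
inductive Stk
  | m | a | b | t | c
  deriving DecidableEq

instance : Fintype Stk where
  elems := {.m, .a, .b, .t, .c}
  complete k := by cases k <;> simp

/-- Stack contents. -/
abbrev Store := Stk → List Γ'

/-- Structured programs. `pop k f` pops the stack `k` and continues with `f o`, where `o` is the
popped symbol (`none` if the stack was empty); `loop k q p` runs `p` as long as the top of the
stack `k` satisfies `q`. -/
inductive Prog
  | skip : Prog
  | push : Stk → Γ' → Prog
  | pop : Stk → (Option Γ' → Prog) → Prog
  | seq : Prog → Prog → Prog
  | loop : Stk → (Option Γ' → Bool) → Prog → Prog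

open Prog Function

/-- `Exec p S S' n`: the program `p` transforms the store `S` into `S'` in `n` steps. -/
inductive Exec : Prog → Store → Store → ℕ → Prop
  | skip (S) : Exec skip S S 1
  | push (k x S) : Exec (push k x) S (update S k (x :: S k)) 1
  | pop {k f S S' n} : Exec (f (S k).head?) (update S k (S k).tail) S' n →
      Exec (pop k f) S S' (n + 1)
  | seq {p q S S' S'' n n'} : Exec p S S' n → Exec q S' S'' n' → Exec (seq p q) S S'' (n + n')
  | loop_done {k q p S} : q (S k).head? = false → Exec (loop k q p) S S 1
  | loop_step {k q p S S' S'' n n'} : q (S k).head? = true → Exec p S S' n →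
      Exec (loop k q p) S' S'' n' → Exec (loop k q p) S S'' (n + n' + 1)

/-- Program points. -/
def Lab : Prog → Type
  | skip => Unit
  | push _ _ => Unit
  | pop _ f => Option (Σ o, Lab (f o))
  | seq p q => Lab p ⊕ Lab q
  | loop _ _ p => Option (Lab p)

instance labFintype : ∀ p, Fintype (Lab p)
  | skip => inferInstanceAs (Fintype Unit)
  | push _ _ => inferInstanceAs (Fintype Unit)
  | pop _ f =>
    haveI := fun o => labFintype (f o)
    inferInstanceAs (Fintype (Option (Σ o, Lab (f o))))
  | seq p q =>
    haveI := labFintype p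
    haveI := labFintype q
    inferInstanceAs (Fintype (Lab p ⊕ Lab q))
  | loop _ _ p =>
    haveI := labFintype p
    inferInstanceAs (Fintype (Option (Lab p)))

/-- The first program point. -/
def entry : ∀ p, Lab p
  | skip => ()
  | push _ _ => ()
  | pop _ _ => none
  | seq p _ => Sum.inl (entry p)
  | loop _ _ _ => none

/-- The statement at each program point, in a machine with labels `Λ` into which the program points
are embedded by `emb`, and which continues at `next`. -/
def code : ∀ (p : Prog) {Λ : Type} (_ : Lab p → Λ) (_ : Λ), Lab p →
    TM2.Stmt (fun _ : Stk => Γ') Λ (Option Γ')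
  | skip, _, _, next, _ => .goto fun _ => next
  | push k x, _, _, next, _ => .push k (fun _ => x) (.goto fun _ => next)
  | pop k f, _, emb, next, l =>
    match l with
    | none => .pop k (fun _ o => o) (.goto fun o => emb (some ⟨o, entry (f o)⟩))
    | some ⟨o, l⟩ => code (f o) (fun l => emb (some ⟨o, l⟩)) next l
  | seq p q, _, emb, next, l =>
    match l with
    | .inl l => code p (fun l => emb (.inl l)) (emb (.inr (entry q))) l
    | .inr l => code q (fun l => emb (.inr l)) next l
  | loop k q p, _, emb, next, l =>
    match l with
    | none => .peek k (fun _ o => o) (.goto fun o => bif q o then emb (some (entry p)) else next)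
    | some l => code p (fun l => emb (some l)) (emb none) l

theorem iterate_bind_add {α : Type*} {f : α → Option α} {x y : α} {z : Option α} {n n' : ℕ}
    (h : (flip bind f)^[n] (some x) = some y) (h' : (flip bind f)^[n'] (some y) = z) :
    (flip bind f)^[n + n'] (some x) = z := by
  rw [add_comm, iterate_add_apply, h, h']

theorem Exec.sound {p : Prog} {S S' : Store} {n : ℕ} (h : Exec p S S' n) {Λ : Type}
    (M : Λ → TM2.Stmt (fun _ : Stk => Γ') Λ (Option Γ')) (emb : Lab p → Λ) (next : Λ)
    (hM : ∀ l, M (emb l) = code p emb next l) (v : Option Γ') :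
    ∃ v', (flip bind (TM2.step M))^[n] (some ⟨some (emb (entry p)), v, S⟩) =
      some ⟨some next, v', S'⟩ := by
  induction h generalizing v next with
  | skip S =>
    refine ⟨v, ?_⟩
    simp [flip, TM2.step, hM, code]
  | push k x S =>
    refine ⟨v, ?_⟩
    simp [flip, TM2.step, hM, code]
  | @pop k f S S' n _ ih =>
    obtain ⟨v', hv'⟩ := ih (fun l => emb (some ⟨_, l⟩)) next (fun l => hM _) (S k).head?
    refine ⟨v', ?_⟩
    rw [iterate_succ_apply, ← hv']
    have h0 := hM (none : Option (Σ o, Lab (f o)))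
    simp only [code] at h0
    congr 1
    simp [flip, TM2.step, entry, h0]
  | @seq p q S S' S'' n n' _ _ ih ih' =>
    obtain ⟨v', hv'⟩ := ih (fun l => emb (.inl l)) (emb (.inr (entry q))) (fun l => hM _) v
    obtain ⟨v'', hv''⟩ := ih' (fun l => emb (.inr l)) next (fun l => hM _) v'
    exact ⟨v'', iterate_bind_add hv' hv''⟩
  | @loop_done k q p S hq =>
    have h0 := hM (none : Option (Lab p))
    simp only [code] at h0
    refine ⟨(S k).head?, ?_⟩
    simp [flip, TM2.step, entry, hq, h0]
  | @loop_step k q p S S' S'' n n' hq _ _ ih ih' =>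
    obtain ⟨v', hv'⟩ := ih (fun l => emb (some l)) (emb none) (fun l => hM _) (S k).head?
    obtain ⟨v'', hv''⟩ := ih' emb next hM v'
    refine ⟨v'', ?_⟩
    rw [iterate_succ_apply, ← iterate_bind_add hv' hv'']
    have h0 := hM (none : Option (Lab p))
    simp only [code] at h0
    congr 1
    simp [flip, TM2.step, entry, hq, h0]

/-- The machine running a program, with input and output on the main stack. -/
def machine (p : Prog) : FinTM2 where
  K := Stk
  k₀ := .m
  k₁ := .m
  Γ _ := Γ'
  Λ := Option (Lab p)
  main := some (entry p)
  σ := Option Γ'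
  initialState := none
  Γk₀Fin := inferInstanceAs (Fintype Γ')
  m l := l.elim (.load (fun _ => none) .halt) (code p some none)

/-- The store with given stacks. -/
def mk (m a b t c : List Γ') : Store
  | .m => m
  | .a => a
  | .b => b
  | .t => t
  | .c => c

section
variable (m a b t c x : List Γ')

@[simp] theorem mk_m : mk m a b t c .m = m := rfl
@[simp] theorem mk_a : mk m a b t c .a = a := rfl
@[simp] theorem mk_b : mk m a b t c .b = b := rfl
@[simp] theorem mk_t : mk m a b t c .t = t := rfl
@[simp] theorem mk_c : mk m a b t c .c = c := rfl
@[simp] theorem update_mk_m : update (mk m a b t c) .m x = mk x a b t c := by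
  ext1 k; cases k <;> simp [update]
@[simp] theorem update_mk_a : update (mk m a b t c) .a x = mk m x b t c := by
  ext1 k; cases k <;> simp [update]
@[simp] theorem update_mk_b : update (mk m a b t c) .b x = mk m a x t c := by
  ext1 k; cases k <;> simp [update]
@[simp] theorem update_mk_t : update (mk m a b t c) .t x = mk m a b x c := by
  ext1 k; cases k <;> simp [update]
@[simp] theorem update_mk_c : update (mk m a b t c) .c x = mk m a b t x := by
  ext1 k; cases k <;> simp [update]

end

/-- A program that computes `f` on codes with a polynomial time bound witnesses polynomial time
computability. -/
noncomputable def polyTimeOfProg {α β : Type} {ea : α → List Γ'} {eb : β → List Γ'} {f : α → β} (p : Prog)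
    (time : Polynomial ℕ)
    (h : ∀ x, ∃ n ≤ time.eval (ea x).length,
      Exec p (mk (ea x) [] [] [] []) (mk (eb (f x)) [] [] [] []) n) :
    TM2ComputableInPolyTime ea eb f where
  tm := machine p
  inputAlphabet := Equiv.refl _
  outputAlphabet := Equiv.refl _
  time := time + 1
  outputsFun x :=
    { steps := (h x).choose + 1
      evals_in_steps := by
        obtain ⟨v, hv⟩ := (h x).choose_spec.2.sound (machine p).m some none (fun _ => rfl) none
        refine iterate_bind_add (α := (machine p).Cfg) (f := (machine p).step) (n' := 1)
          (y := (⟨some none, v, mk (eb (f x)) [] [] [] []⟩ :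
            TM2.Cfg (fun _ : Stk => Γ') (Option (Lab p)) (Option Γ'))) ?_ ?_
        · refine Eq.trans (congrArg _ (congrArg some ?_)) hv
          refine congrArg (TM2.Cfg.mk _ _) ?_
          funext k
          cases k <;> simp [mk, machine]
          rfl
        · refine congrArg some ?_
          refine congrArg (TM2.Cfg.mk _ _) ?_
          funext k
          cases k <;> simp [mk, machine]
          rfl
      steps_le_m := by
        have := (h x).choose_spec.1
        simpa using this }

end StackProg

/-! ## Self-delimiting codes and moving them between stacks -/

namespace StackProg

open Computability Turing Prog Function

/-- Strings with balanced brackets (and without blanks). -/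
inductive Bal : List Γ' → Prop
  | nil : Bal []
  | atom {x t} : x ≠ Γ'.bra → x ≠ Γ'.ket → x ≠ Γ'.blank → Bal t → Bal (x :: t)
  | node {s t} : Bal s → Bal t → Bal (Γ'.bra :: (s ++ Γ'.ket :: t))

theorem Bal.append {s t : List Γ'} (hs : Bal s) (ht : Bal t) : Bal (s ++ t) := by
  induction hs with
  | nil => exact ht
  | atom h1 h2 h3 _ ih => exact .atom h1 h2 h3 ih
  | node h1 _ _ ih => simpa using Bal.node h1 ih

theorem Bal.blank_notMem {s : List Γ'} (hs : Bal s) : Γ'.blank ∉ s := by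
  induction hs with
  | nil => simp
  | atom h1 h2 h3 _ ih => simp [ih, h3.symm]
  | node _ _ ih ih' => simp [ih, ih']

theorem Bal.flatMap {α : Type} {e : α → List Γ'} {l : List α} (h : ∀ x, Bal (e x)) :
    Bal (l.flatMap e) := by
  induction l with
  | nil => exact .nil
  | cons x l ih => exact (h x).append ih

theorem bal_bits (l : List Bool) : Bal (l.map Γ'.bit ++ [Γ'.comma]) := by
  induction l with
  | nil => exact .atom (by simp) (by simp) (by simp) .nil
  | cons x l ih => exact .atom (by simp) (by simp) (by simp) ih

/-- The codes of single objects: numbers and bracketed strings. -/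
def IsObj (l : List Γ') : Prop :=
  (∃ s : List Bool, l = s.map Γ'.bit ++ [Γ'.comma]) ∨ ∃ s, Bal s ∧ l = Γ'.bra :: (s ++ [Γ'.ket])

theorem IsObj.bal {l : List Γ'} (h : IsObj l) : Bal l := by
  obtain ⟨s, rfl⟩ | ⟨s, hs, rfl⟩ := h
  · exact bal_bits s
  · exact .node hs .nil

theorem IsObj.head_ne_ket {l : List Γ'} (h : IsObj l) (r : List Γ') :
    (l ++ r).head? ≠ some Γ'.ket := by
  obtain ⟨s, rfl⟩ | ⟨s, hs, rfl⟩ := h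
  · cases s <;> simp
  · simp

/-- `p` transforms `S` into `S'` in at most `N` steps. -/
def Runs (p : Prog) (S S' : Store) (N : ℕ) : Prop := ∃ n ≤ N, Exec p S S' n

namespace Runs

variable {p q : Prog} {S S' S'' : Store} {N N' : ℕ}

theorem mono (h : Runs p S S' N) (hN : N ≤ N') : Runs p S S' N' :=
  let ⟨n, hn, e⟩ := h; ⟨n, hn.trans hN, e⟩

theorem congr (h : Runs p S S' N) (hS : S' = S'') (hN : N ≤ N') : Runs p S S'' N' :=
  hS ▸ h.mono hN

theorem skip : Runs skip S S 1 := ⟨1, le_rfl, .skip S⟩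

theorem push {k : Stk} {x : Γ'} : Runs (push k x) S (update S k (x :: S k)) 1 :=
  ⟨1, le_rfl, .push k x S⟩

theorem pop {k : Stk} {f : Option Γ' → Prog}
    (h : Runs (f (S k).head?) (update S k (S k).tail) S' N) : Runs (pop k f) S S' (N + 1) :=
  let ⟨n, hn, e⟩ := h; ⟨n + 1, by omega, .pop e⟩

theorem seq (h : Runs p S S' N) (h' : Runs q S' S'' N') : Runs (seq p q) S S'' (N + N') :=
  let ⟨n, hn, e⟩ := h; let ⟨n', hn', e'⟩ := h'; ⟨n + n', by omega, .seq e e'⟩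

theorem loop_done {k : Stk} {c : Option Γ' → Bool} (h : c (S k).head? = false) :
    Runs (loop k c p) S S 1 := ⟨1, le_rfl, .loop_done h⟩

theorem loop_step {k : Stk} {c : Option Γ' → Bool} (h : c (S k).head? = true)
    (h' : Runs p S S' N) (h'' : Runs (loop k c p) S' S'' N') :
    Runs (loop k c p) S S'' (N + N' + 1) :=
  let ⟨n, hn, e⟩ := h'; let ⟨n', hn', e'⟩ := h''; ⟨n + n' + 1, by omega, .loop_step h e e'⟩

theorem push_seq {k : Stk} {x : Γ'} (h : Runs p (update S k (x :: S k)) S' N) :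
    Runs (Prog.seq (Prog.push k x) p) S S' (N + 1) :=
  (push.seq h).mono (by omega)

end Runs

theorem Exec.length_le {p : Prog} {S S' : Store} {n : ℕ} (h : Exec p S S' n) (k : Stk) :
    (S' k).length ≤ (S k).length + n := by
  induction h with
  | skip => omega
  | push j x S =>
    by_cases h : k = j
    · subst h; simp
    · simp [update_of_ne h]
  | @pop j f S S' n _ ih =>
    by_cases h : k = j
    · subst h; simp at ih; omega
    · simp [update_of_ne h] at ih; omega
  | seq _ _ ih ih' => omega
  | loop_done => omega
  | loop_step _ _ _ ih ih' => omega

/-- Overwrite three stacks: a given one, the transfer stack and the counter stack. -/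
def overwrite (S : Store) (k : Stk) (x t c : List Γ') : Store :=
  update (update (update S k x) .t t) .c c

section overwrite

variable {S : Store} {k : Stk} {x t c y : List Γ'} (ht : k ≠ .t) (hc : k ≠ .c)

theorem overwrite_self : overwrite S k (S k) (S .t) (S .c) = S := by
  simp [overwrite]

include ht hc in
theorem overwrite_k : overwrite S k x t c k = x := by
  simp [overwrite, update_of_ne ht, update_of_ne hc]

theorem overwrite_t : overwrite S k x t c .t = t := by
  simp [overwrite]

theorem overwrite_c : overwrite S k x t c .c = c := by
  simp [overwrite]

include ht hc in
theorem update_overwrite_k : update (overwrite S k x t c) k y = overwrite S k y t c := by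
  simp only [overwrite]
  rw [update_comm hc.symm, update_comm ht.symm, update_idem]

theorem update_overwrite_t : update (overwrite S k x t c) .t y = overwrite S k x y c := by
  simp only [overwrite]
  rw [update_comm (by decide), update_idem]

theorem update_overwrite_c : update (overwrite S k x t c) .c y = overwrite S k x t y := by
  simp [overwrite]

end overwrite

/-- Move one symbol from the stack `k` to the transfer stack. -/
def xfer (k : Stk) : Prog := pop k fun
  | some x => push .t x
  | none => skip

/-- One step of moving a bracketed string to the transfer stack; the depth is on the counter
stack. -/
def scanStep (k : Stk) : Prog := pop k fun
  | some Γ'.bra => seq (push .t Γ'.bra) (push .c Γ'.bra)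
  | some Γ'.ket => seq (push .t Γ'.ket) (pop .c fun _ => skip)
  | some x => push .t x
  | none => skip

/-- Move an object from the stack `k` to the transfer stack, in reverse, above a blank. -/
def take (k : Stk) : Prog := seq (push .t Γ'.blank) <| pop k fun
  | some Γ'.comma => push .t Γ'.comma
  | some (Γ'.bit x) => seq (push .t (Γ'.bit x)) <|
      seq (loop k (fun o => o ≠ some Γ'.comma) (xfer k)) (xfer k)
  | some Γ'.bra => seq (push .t Γ'.bra) <| seq (push .c Γ'.blank) <| seq (push .c Γ'.bra) <|
      seq (loop .c (fun o => o = some Γ'.bra) (scanStep k)) (pop .c fun _ => skip)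
  | _ => skip

section take

variable {S S' : Store} {k : Stk} {r t c : List Γ'} {N : ℕ} (ht : k ≠ .t) (hc : k ≠ .c)

include ht hc in
theorem runs_xfer {x : Γ'} : Runs (xfer k) (overwrite S k (x :: r) t c)
    (overwrite S k r (x :: t) c) 2 := by
  refine Runs.pop ?_
  rw [overwrite_k ht hc, update_overwrite_k ht hc]
  exact Runs.push.congr (by rw [overwrite_t, update_overwrite_t]; rfl) le_rfl

include ht hc in
theorem runs_bits_loop (s : List Bool) :
    Runs (loop k (fun o => o ≠ some Γ'.comma) (xfer k))
      (overwrite S k (s.map Γ'.bit ++ Γ'.comma :: r) t c)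
      (overwrite S k (Γ'.comma :: r) ((s.map Γ'.bit).reverse ++ t) c) (3 * s.length + 1) := by
  induction s generalizing t with
  | nil => exact (Runs.loop_done (by simp [overwrite_k ht hc])).congr rfl (by simp)
  | cons x s ih =>
    refine (Runs.loop_step (by simp [overwrite_k ht hc]) (runs_xfer ht hc) ih).congr ?_ ?_
    · simp
    · simp; omega

include ht hc in
theorem runs_scan_loop {s : List Γ'} (hs : Bal s) {r t c : List Γ'} {S' : Store} {N : ℕ}
    (h : Runs (loop .c (fun o => o = some Γ'.bra) (scanStep k))
      (overwrite S k r (s.reverse ++ t) (Γ'.bra :: c)) S' N) :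
    Runs (loop .c (fun o => o = some Γ'.bra) (scanStep k))
      (overwrite S k (s ++ r) t (Γ'.bra :: c)) S' (5 * s.length + N) := by
  induction hs generalizing r t c N with
  | nil => simpa using h
  | @atom x s h1 h2 h3 _ ih =>
    have := ih (r := r) (t := x :: t) (c := c) (N := N) (by simpa using h)
    refine (Runs.loop_step (by simp [overwrite_c]) (N := 2) ?_ this).congr rfl ?_
    · refine Runs.pop ?_
      rw [overwrite_k ht hc, update_overwrite_k ht hc]
      have e : ∀ y : Γ', y ≠ Γ'.bra → y ≠ Γ'.ket → Runs (push .t y)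
          (overwrite S k (s ++ r) t (Γ'.bra :: c))
          (overwrite S k (s ++ r) (y :: t) (Γ'.bra :: c)) 1 := fun y _ _ =>
        Runs.push.congr (by rw [overwrite_t, update_overwrite_t]) le_rfl
      cases x <;> first | exact e _ h1 h2 | simp at h1 h2
    · simp; omega
  | @node s s' _ _ ih ih' =>
    have h1 := ih' (r := r) (t := Γ'.ket :: (s.reverse ++ Γ'.bra :: t)) (c := c) (N := N)
      (by simpa using h)
    have h2 : Runs (loop .c (fun o => o = some Γ'.bra) (scanStep k))
        (overwrite S k (Γ'.ket :: (s' ++ r)) (s.reverse ++ Γ'.bra :: t) (Γ'.bra :: Γ'.bra :: c))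
        S' (4 + (5 * s'.length + N) + 1) := by
      refine (Runs.loop_step (by simp [overwrite_c]) (N := 4) ?_ h1).congr rfl (by omega)
      refine Runs.pop ?_
      rw [overwrite_k ht hc, update_overwrite_k ht hc]
      refine Runs.push_seq ?_
      rw [overwrite_t, update_overwrite_t]
      refine Runs.pop ?_
      rw [overwrite_c, update_overwrite_c]
      exact Runs.skip
    have h3 := ih h2
    refine (Runs.loop_step (S' := overwrite S k (s ++ Γ'.ket :: (s' ++ r)) (Γ'.bra :: t)
      (Γ'.bra :: Γ'.bra :: c)) (by simp [overwrite_c]) (N := 3) ?_ h3).congr rfl ?_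
    · refine Runs.pop ?_
      rw [overwrite_k ht hc, update_overwrite_k ht hc]
      refine Runs.push_seq ?_
      rw [overwrite_t, update_overwrite_t]
      refine Runs.push.congr ?_ le_rfl
      rw [overwrite_c, update_overwrite_c]
      simp
    · simp; omega

include ht hc in
theorem runs_take {o : List Γ'} (ho : IsObj o) : Runs (take k) (overwrite S k (o ++ r) t c)
    (overwrite S k r (o.reverse ++ Γ'.blank :: t) c) (5 * o.length + 10) := by
  obtain ⟨s, rfl⟩ | ⟨s, hs, rfl⟩ := ho
  · cases s with
    | nil =>
      refine Runs.mono (Runs.push_seq (N := 2) (Runs.pop ?_)) (by simp)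
      rw [overwrite_t, update_overwrite_t, overwrite_k ht hc, update_overwrite_k ht hc]
      exact Runs.push.congr (by rw [overwrite_t, update_overwrite_t]; rfl) le_rfl
    | cons x s =>
      refine Runs.mono (N := 3 * s.length + 6) (Runs.push_seq (Runs.pop ?_)) (by simp; omega)
      rw [overwrite_t, update_overwrite_t, overwrite_k ht hc, update_overwrite_k ht hc]
      refine Runs.push_seq ?_
      rw [overwrite_t, update_overwrite_t]
      have := ((runs_bits_loop (S := S) (r := r) (t := Γ'.bit x :: Γ'.blank :: t) (c := c)
        ht hc s).seq (runs_xfer ht hc))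
      simpa using this
  · refine Runs.mono (N := 5 * s.length + 13) (Runs.push_seq (Runs.pop ?_)) (by simp; omega)
    rw [overwrite_t, update_overwrite_t, overwrite_k ht hc, update_overwrite_k ht hc]
    refine Runs.push_seq (Runs.push_seq (Runs.push_seq ?_))
    rw [overwrite_t, update_overwrite_t, overwrite_c, update_overwrite_c, overwrite_c,
      update_overwrite_c]
    refine Runs.mono (N := (5 * s.length + 6) + 2) (Runs.seq (S' := overwrite S k r
      ((Γ'.bra :: (s ++ [Γ'.ket])).reverse ++ Γ'.blank :: t) (Γ'.blank :: c)) ?_ ?_) (by omega)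
    · have := runs_scan_loop (S := S) ht hc hs (r := Γ'.ket :: r)
        (t := Γ'.bra :: Γ'.blank :: t)
        (c := Γ'.blank :: c) (S' := overwrite S k r
          ((Γ'.bra :: (s ++ [Γ'.ket])).reverse ++ Γ'.blank :: t) (Γ'.blank :: c)) (N := 6) ?_
      · simpa using this
      · refine (Runs.loop_step (by simp [overwrite_c]) (N := 4) ?_ (Runs.loop_done ?_)).congr
          rfl (by omega)
        · refine Runs.pop ?_
          simp only [overwrite_k ht hc, update_overwrite_k ht hc]
          refine Runs.push_seq ?_
          rw [overwrite_t, update_overwrite_t]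
          refine Runs.pop ?_
          rw [overwrite_c, update_overwrite_c]
          refine Runs.skip.congr ?_ le_rfl
          simp
        · simp [overwrite_c]
    · refine Runs.pop ?_
      rw [overwrite_c, update_overwrite_c]
      exact Runs.skip

end take

end StackProg

namespace StackProg

open Computability Turing Prog Function

/-- Push a symbol on several stacks. -/
def pushAll : List Stk → Γ' → Prog
  | [], _ => skip
  | k :: ks, x => seq (push k x) (pushAll ks x)

/-- Add a string on top of several stacks. -/
def addTo (ks : List Stk) (o : List Γ') (S : Store) : Store :=
  fun j => if j ∈ ks then o ++ S j else S j

theorem runs_pushAll {ks : List Stk} (hks : ks.Nodup) (x : Γ') (S : Store) :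
    Runs (pushAll ks x) S (addTo ks [x] S) (ks.length + 1) := by
  induction ks generalizing S with
  | nil => exact Runs.skip.congr (by funext j; simp [addTo]) (by simp)
  | cons k ks ih =>
    rw [List.nodup_cons] at hks
    refine (Runs.push_seq (ih hks.2 _)).congr ?_ (by simp)
    funext j
    by_cases h : j = k
    · subst h; simp [addTo, hks.1]
    · simp [addTo, h]

/-- Move a string above a blank from the transfer stack to several stacks. -/
def put (ks : List Stk) : Prog :=
  seq (loop .t (fun o => o ≠ some Γ'.blank) (pop .t fun
    | some x => pushAll ks x
    | none => skip)) (pop .t fun _ => skip)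

theorem runs_put {ks : List Stk} (hks : ks.Nodup) (ht : .t ∉ ks) {o : List Γ'}
    (ho : Γ'.blank ∉ o) {t : List Γ'} (S : Store) (hS : S .t = o ++ Γ'.blank :: t) :
    Runs (put ks) S (addTo ks o.reverse (update S .t t)) ((ks.length + 3) * o.length + 3) := by
  have key : ∀ (o : List Γ') (_ : Γ'.blank ∉ o) (S : Store) (_ : S .t = o ++ Γ'.blank :: t),
      Runs (loop .t (fun o => o ≠ some Γ'.blank) (pop .t fun
        | some x => pushAll ks x
        | none => skip)) S (addTo ks o.reverse (update S .t (Γ'.blank :: t)))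
        ((ks.length + 3) * o.length + 1) := by
    intro o
    induction o with
    | nil =>
      intro _ S hS
      refine (Runs.loop_done (by simp [hS])).congr ?_ (by simp)
      funext j
      by_cases h : j = .t
      · subst h; simp [addTo, ht, hS]
      · simp [addTo, update_of_ne h]
    | cons x o ih =>
      intro ho S hS
      simp only [List.mem_cons, not_or] at ho
      have h1 : Runs (pop .t fun
          | some x => pushAll ks x
          | none => skip) S (addTo ks [x] (update S .t (o ++ Γ'.blank :: t)))
          (ks.length + 1 + 1) := by
        refine Runs.pop ?_
        simp only [hS, List.cons_append, List.head?_cons, List.tail_cons]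
        exact runs_pushAll hks x _
      refine (Runs.loop_step (by simp [hS, Ne.symm ho.1]) h1
        (ih ho.2 _ (by simp [addTo, ht]))).congr ?_ ?_
      · funext j
        by_cases h : j = .t
        · subst h; simp [addTo, ht]
        · by_cases h' : j ∈ ks <;> simp [addTo, update_of_ne h, h']
      · simp; ring_nf; omega
  refine ((key o ho S hS).seq (Runs.pop Runs.skip)).congr ?_ (by omega)
  funext j
  by_cases h : j = .t
  · subst h; simp [addTo, ht]
  · by_cases h' : j ∈ ks <;> simp [addTo, update_of_ne h, h']

/-- Move the object on top of the stack `k` to several stacks. -/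
def mv (k : Stk) (ks : List Stk) : Prog := seq (take k) (put ks)

theorem runs_mv {k : Stk} {ks : List Stk} {o r : List Γ'} {S : Store} (ht : k ≠ .t) (hc : k ≠ .c)
    (hks : ks.Nodup) (ht' : .t ∉ ks) (hl : ks.length ≤ 2) (ho : IsObj o) (hS : S k = o ++ r) :
    Runs (mv k ks) S (addTo ks o (update S k r)) (10 * o.length + 13) := by
  have h1 := runs_take (S := S) (r := r) (t := S .t) (c := S .c) ht hc ho
  rw [← hS, overwrite_self] at h1
  refine (h1.seq (runs_put hks ht' (o := o.reverse) (by simpa using ho.bal.blank_notMem) _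
    (overwrite_t))).congr ?_ ?_
  · rw [List.reverse_reverse, update_overwrite_t]
    congr 1
    rw [overwrite, update_eq_self_iff.2, update_eq_self_iff.2]
    · simp [update_of_ne ht.symm]
    · simp [update_of_ne hc.symm]
  · simp
    nlinarith

section instances

variable {o m a b t c : List Γ'} (ho : IsObj o)

include ho

theorem runs_mv_m_a : Runs (mv .m [.a]) (mk (o ++ m) a b t c) (mk m (o ++ a) b t c)
    (10 * o.length + 13) :=
  (runs_mv (by decide) (by decide) (by decide) (by decide) (by decide) ho rfl).congr
    (by funext j; cases j <;> simp [addTo]) le_rfl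

theorem runs_mv_m_b : Runs (mv .m [.b]) (mk (o ++ m) a b t c) (mk m a (o ++ b) t c)
    (10 * o.length + 13) :=
  (runs_mv (by decide) (by decide) (by decide) (by decide) (by decide) ho rfl).congr
    (by funext j; cases j <;> simp [addTo]) le_rfl

theorem runs_mv_a_m : Runs (mv .a [.m]) (mk m (o ++ a) b t c) (mk (o ++ m) a b t c)
    (10 * o.length + 13) :=
  (runs_mv (by decide) (by decide) (by decide) (by decide) (by decide) ho rfl).congr
    (by funext j; cases j <;> simp [addTo]) le_rfl

theorem runs_mv_b_m : Runs (mv .b [.m]) (mk m a (o ++ b) t c) (mk (o ++ m) a b t c)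
    (10 * o.length + 13) :=
  (runs_mv (by decide) (by decide) (by decide) (by decide) (by decide) ho rfl).congr
    (by funext j; cases j <;> simp [addTo]) le_rfl

theorem runs_dup_m_a : Runs (mv .m [.m, .a]) (mk (o ++ m) a b t c) (mk (o ++ m) (o ++ a) b t c)
    (10 * o.length + 13) :=
  (runs_mv (by decide) (by decide) (by decide) (by decide) (by decide) ho rfl).congr
    (by funext j; cases j <;> simp [addTo]) le_rfl

theorem runs_dup_a_m : Runs (mv .a [.m, .a]) (mk m (o ++ a) b t c) (mk (o ++ m) (o ++ a) b t c)
    (10 * o.length + 13) :=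
  (runs_mv (by decide) (by decide) (by decide) (by decide) (by decide) ho rfl).congr
    (by funext j; cases j <;> simp [addTo]) le_rfl

theorem runs_drop_m : Runs (mv .m []) (mk (o ++ m) a b t c) (mk m a b t c)
    (10 * o.length + 13) :=
  (runs_mv (by decide) (by decide) (by decide) (by decide) (by decide) ho rfl).congr
    (by funext j; cases j <;> simp [addTo]) le_rfl

theorem runs_drop_a : Runs (mv .a []) (mk m (o ++ a) b t c) (mk m a b t c)
    (10 * o.length + 13) :=
  (runs_mv (by decide) (by decide) (by decide) (by decide) (by decide) ho rfl).congr
    (by funext j; cases j <;> simp [addTo]) le_rfl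

end instances

section

variable {x : Γ'} {m a b t c : List Γ'}

theorem runs_push_m : Runs (push .m x) (mk m a b t c) (mk (x :: m) a b t c) 1 :=
  Runs.push.congr (by simp) le_rfl

theorem runs_pop_m : Runs (pop .m fun _ => skip) (mk (x :: m) a b t c) (mk m a b t c) 2 :=
  Runs.pop (Runs.skip.congr (by simp) le_rfl)

theorem runs_pop_b : Runs (pop .b fun _ => skip) (mk m a (x :: b) t c) (mk m a b t c) 2 :=
  Runs.pop (Runs.skip.congr (by simp) le_rfl)

/-- Push a string on the main stack. -/
def pushStr : List Γ' → Prog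
  | [] => skip
  | x :: s => seq (pushStr s) (push .m x)

theorem runs_pushStr (l : List Γ') :
    Runs (pushStr l) (mk m a b t c) (mk (l ++ m) a b t c) (l.length + 1) := by
  induction l with
  | nil => exact Runs.skip
  | cons x l ih => exact (ih.seq runs_push_m).congr rfl (by simp)

end

/-! ## Polynomial time functions -/

/-- Types whose elements are encoded as single objects. -/
class Obj (α : Type) where
  enc : α → List Γ'
  isObj : ∀ x, IsObj (enc x)

open Obj

instance : Obj ℕ where
  enc := InstanceEncoding.encodeNumber
  isObj a := Or.inl ⟨encodeNat a, rfl⟩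

instance {α : Type} [Obj α] : Obj (List α) where
  enc l := Γ'.bra :: (l.flatMap enc ++ [Γ'.ket])
  isObj _ := Or.inr ⟨_, Bal.flatMap fun x => (isObj x).bal, rfl⟩

instance {α β : Type} [Obj α] [Obj β] : Obj (α × β) where
  enc x := Γ'.bra :: (enc x.1 ++ enc x.2 ++ [Γ'.ket])
  isObj x := Or.inr ⟨_, (isObj x.1).bal.append (isObj x.2).bal, rfl⟩

section

variable {α β γ δ : Type} [Obj α] [Obj β] [Obj γ] [Obj δ]

/-- The length of the code. -/
def size (x : α) : ℕ := (enc x).length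

theorem enc_pair (x : α) (y : β) : enc (x, y) = Γ'.bra :: (enc x ++ enc y ++ [Γ'.ket]) := rfl

theorem enc_list (l : List α) : enc l = Γ'.bra :: (l.flatMap enc ++ [Γ'.ket]) := rfl

theorem size_pair (x : α) (y : β) : size (x, y) = size x + size y + 2 := by
  simp [size, enc_pair, add_assoc]

@[simp] theorem size_nil : size ([] : List α) = 2 := rfl

theorem size_cons (x : α) (l : List α) : size (x :: l) = size x + size l := by
  simp [size, enc_list]; omega

theorem one_le_size (x : α) : 1 ≤ size x := by
  obtain ⟨s, h⟩ | ⟨s, -, h⟩ := isObj x <;> simp [size, h]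

theorem length_le_size (l : List α) : l.length ≤ size l := by
  induction l with
  | nil => simp
  | cons x l ih =>
    have := one_le_size x
    rw [size_cons]
    simp
    omega

theorem size_le_of_mem {x : α} {l : List α} (h : x ∈ l) : size x ≤ size l := by
  induction l with
  | nil => simp at h
  | cons y l ih =>
    rw [size_cons]
    rcases List.mem_cons.1 h with rfl | h
    · omega
    · have := ih h; omega

theorem size_le_of_forall {l : List α} {B : ℕ} (h : ∀ x ∈ l, size x ≤ B) :
    size l ≤ l.length * B + 2 := by
  induction l with
  | nil => simp
  | cons y l ih =>
    simp only [List.mem_cons, forall_eq_or_imp] at h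
    have := ih h.2
    rw [size_cons, List.length_cons]
    linarith [h.1]

/-- Computability in polynomial time, on top of the main stack, without changing the rest of the
store. -/
def Poly (f : α → β) : Prop :=
  ∃ (P : Prog) (p : Polynomial ℕ), ∀ (x : α) (m a b t c : List Γ'),
    Runs P (mk (enc x ++ m) a b t c) (mk (enc (f x) ++ m) a b t c) (p.eval (size x))

theorem eval_mono (p : Polynomial ℕ) {n n' : ℕ} (h : n ≤ n') : p.eval n ≤ p.eval n' := by
  simp only [Polynomial.eval_eq_sum, Polynomial.sum]
  gcongr

/-- Codes of the values are of polynomial size. -/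
def PolySize (f : α → β) : Prop := ∃ p : Polynomial ℕ, ∀ x, size (f x) ≤ p.eval (size x)

theorem Poly.polySize {f : α → β} (h : Poly f) : PolySize f := by
  obtain ⟨P, p, h⟩ := h
  refine ⟨p + .X, fun x => ?_⟩
  obtain ⟨n, hn, e⟩ := h x [] [] [] [] []
  have := e.length_le .m
  simp [size] at *
  omega

namespace Poly

theorem id : Poly (fun x : α => x) :=
  ⟨Prog.skip, 1, fun _ _ _ _ _ _ => by simpa using Runs.skip⟩

theorem comp {g : β → γ} {f : α → β} (hg : Poly g) (hf : Poly f) : Poly (fun x => g (f x)) := by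
  obtain ⟨q, hq⟩ := hf.polySize
  obtain ⟨P, p, h⟩ := hf
  obtain ⟨P', p', h'⟩ := hg
  refine ⟨P.seq P', p + p'.comp q, fun x m a b t c => ?_⟩
  refine ((h x m a b t c).seq (h' (f x) m a b t c)).mono ?_
  simpa using eval_mono p' (hq x)

theorem const (y : β) : Poly (fun _ : α => y) := by
  refine ⟨(mv .m []).seq (pushStr (enc y)), 10 * .X + .C (size y + 14), fun x m a b t c => ?_⟩
  refine ((runs_drop_m (isObj x)).seq (runs_pushStr (enc y))).mono ?_
  simp [size]
  omega

theorem pair {f : α → β} {g : α → γ} (hf : Poly f) (hg : Poly g) :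
    Poly (fun x => (f x, g x)) := by
  obtain ⟨q, hq⟩ := hf.polySize
  obtain ⟨q', hq'⟩ := hg.polySize
  obtain ⟨P, p, h⟩ := hf
  obtain ⟨P', p', h'⟩ := hg
  refine ⟨(mv .m [.m, .a]).seq <| P.seq <| (mv .a [.m]).seq <| P'.seq <| (mv .m [.a]).seq <|
    (mv .m [.b]).seq <| (push .m Γ'.ket).seq <| (mv .a [.m]).seq <| (mv .b [.m]).seq <|
    push .m Γ'.bra, 20 * .X + p + p' + 20 * q + 20 * q' + 100, fun x m a b t c => ?_⟩
  refine ((runs_dup_m_a (isObj x)).seq <| (h x _ _ _ _ _).seq <| (runs_mv_a_m (isObj x)).seq <|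
    (h' x _ _ _ _ _).seq <| (runs_mv_m_a (isObj _)).seq <| (runs_mv_m_b (isObj _)).seq <|
    runs_push_m.seq <| (runs_mv_a_m (isObj _)).seq <| (runs_mv_b_m (isObj _)).seq <|
    runs_push_m).congr ?_ ?_
  · simp [enc_pair]
  · have h1 := hq x
    have h2 := hq' x
    simp [size] at *
    omega

theorem fst : Poly (fun x : α × β => x.1) := by
  refine ⟨(pop .m fun _ => skip).seq <| (mv .m [.a]).seq <| (mv .m []).seq <|
    (pop .m fun _ => skip).seq (mv .a [.m]), 30 * .X + 100, fun ⟨x, y⟩ m a b t c => ?_⟩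
  simp only [enc_pair, List.cons_append, List.append_assoc]
  refine (runs_pop_m.seq <| (runs_mv_m_a (isObj _)).seq <| (runs_drop_m (isObj _)).seq <|
    runs_pop_m.seq (runs_mv_a_m (isObj _))).mono ?_
  simp [size_pair]
  simp [size]
  omega

theorem snd : Poly (fun x : α × β => x.2) := by
  refine ⟨(pop .m fun _ => skip).seq <| (mv .m []).seq <| (mv .m [.a]).seq <|
    (pop .m fun _ => skip).seq (mv .a [.m]), 30 * .X + 100, fun ⟨x, y⟩ m a b t c => ?_⟩
  simp only [enc_pair, List.cons_append, List.append_assoc]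
  refine (runs_pop_m.seq <| (runs_drop_m (isObj _)).seq <| (runs_mv_m_a (isObj _)).seq <|
    runs_pop_m.seq (runs_mv_a_m (isObj _))).mono ?_
  simp [size_pair]
  simp [size]
  omega

theorem cons {f : α → β} {g : α → List β} (hf : Poly f) (hg : Poly g) :
    Poly (fun x => f x :: g x) := by
  refine comp (g := fun p : β × List β => p.1 :: p.2) ?_ (pair hf hg)
  refine ⟨(pop .m fun _ => skip).seq <| (mv .m [.a]).seq <| (mv .m [.b]).seq <|
    (pop .m fun _ => skip).seq <| (mv .b [.m]).seq <| (pop .m fun _ => skip).seq <|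
    (mv .a [.m]).seq (push .m Γ'.bra), 40 * .X + 100, fun ⟨x, y⟩ m a b t c => ?_⟩
  simp only [enc_pair, List.cons_append, List.append_assoc]
  refine (runs_pop_m.seq <| (runs_mv_m_a (isObj _)).seq <| (runs_mv_m_b (isObj _)).seq <|
    runs_pop_m.seq <| (runs_mv_b_m (isObj _)).seq <| Runs.seq (S' := mk (y.flatMap enc ++
      Γ'.ket :: m) (enc x ++ a) b t c) (N := 2) ?_ <|
    (runs_mv_a_m (isObj _)).seq runs_push_m).congr ?_ ?_
  · refine runs_pop_m.congr ?_ le_rfl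
    simp
  · simp [enc_list]
  · simp [size_pair]
    simp [size]
    omega

/-- Case distinction on whether a number is zero. -/
theorem ite_zero {n : α → ℕ} {f g : α → β} (hn : Poly n) (hf : Poly f) (hg : Poly g) :
    Poly (fun x => if n x = 0 then f x else g x) := by
  obtain ⟨q, hq⟩ := hn.polySize
  obtain ⟨P, p, h⟩ := hn
  obtain ⟨P', p', h'⟩ := hf
  obtain ⟨P'', p'', h''⟩ := hg
  refine ⟨(mv .m [.m, .a]).seq <| P.seq <| pop .m fun o =>
    if o = some Γ'.comma then (mv .a [.m]).seq P' else
      (mv .m []).seq <| (mv .a [.m]).seq P'', 40 * .X + p + p' + p'' + 20 * q + 100,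
    fun x m a b t c => ?_⟩
  have h1 := hq x
  have e : enc (n x) = (encodeNat (n x)).map Γ'.bit ++ [Γ'.comma] := rfl
  simp only [size] at h1
  refine ((runs_dup_m_a (isObj x)).seq <| (h x _ _ _ _ _).seq <| Runs.pop
    (N := 20 * size x + p'.eval (size x) + p''.eval (size x) + 10 * (enc (n x)).length + 50)
    ?_).mono ?_
  · by_cases h0 : n x = 0
    · replace e : enc (n x) = [Γ'.comma] := by rw [h0]; rfl
      simp only [mk_m, e, List.cons_append, List.nil_append, List.head?_cons, List.tail_cons,
        update_mk_m, if_true]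
      refine ((runs_mv_a_m (isObj x)).seq ((h' x _ _ _ _ _))).congr ?_ ?_
      · simp [h0]
      · simp [size]
        omega
    · obtain ⟨y, s, hs⟩ : ∃ y s, encodeNat (n x) = y :: s := by
        refine List.exists_cons_of_ne_nil fun h1 => h0 ?_
        rw [← decode_encodeNat (n x), h1]
        rfl
      rw [hs] at e
      have hobj : IsObj (s.map Γ'.bit ++ [Γ'.comma]) := Or.inl ⟨s, rfl⟩
      simp only [mk_m, h0, e, if_false]
      have := (runs_drop_m hobj (m := m) (a := enc x ++ a) (b := b) (t := t) (c := c)).seq <|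
        (runs_mv_a_m (isObj x)).seq (h'' x m a b t c)
      simp only [List.map_cons, List.cons_append, List.head?_cons, Option.some.injEq, reduceCtorEq,
        ↓reduceIte, List.tail_cons, update_mk_m, List.append_assoc] at this ⊢
      refine this.mono ?_
      simp [size]
      omega
  · simp [size] at *
    omega

end Poly

end

end StackProg

namespace StackProg

open Computability Turing Prog Function
open Obj

section

variable {α β γ δ : Type} [Obj α] [Obj β] [Obj γ] [Obj δ]

/-- The loop of a fold over the list on the stack `b`, with the context on the stack `a`. -/
def foldLoop (P : Prog) : Prog := loop .b (fun o => o ≠ some Γ'.ket) <|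
  (mv .m [.a]).seq <| (push .m Γ'.ket).seq <| (push .m Γ'.ket).seq <| (mv .b [.m]).seq <|
    (mv .a [.m]).seq <| (push .m Γ'.bra).seq <| (mv .a [.m, .a]).seq <| (push .m Γ'.bra).seq P

theorem runs_foldLoop {P : Prog} {p : Polynomial ℕ} {f : α → γ → β → γ}
    (hP : ∀ (x : α × γ × β) (m a b t c : List Γ'),
      Runs P (mk (enc x ++ m) a b t c) (mk (enc (f x.1 x.2.1 x.2.2) ++ m) a b t c)
        (p.eval (size x)))
    {x : α} {Q R : ℕ} {l : List β} (hl : ∀ z ∈ l, size z ≤ R) {y : γ}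
    (hy : ∀ n, size ((l.take n).foldl (f x) y) ≤ Q) (m a b t c : List Γ') :
    Runs (foldLoop P) (mk (enc y ++ m) (enc x ++ a) (l.flatMap enc ++ Γ'.ket :: b) t c)
      (mk (enc (l.foldl (f x) y) ++ m) (enc x ++ a) (Γ'.ket :: b) t c)
      (l.length * (20 * Q + 10 * R + 10 * size x + 60 + p.eval (size x + Q + R + 4)) + 1) := by
  induction l generalizing y with
  | nil => exact (Runs.loop_done (by simp)).congr rfl (by simp)
  | cons z l ih =>
    simp only [List.mem_cons, forall_eq_or_imp] at hl
    have h0 : size y ≤ Q := by simpa using hy 0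
    have h1 := ih hl.2 (y := f x y z) (fun n => by simpa using hy (n + 1))
    have h2 : p.eval (size (x, y, z)) ≤ p.eval (size x + Q + R + 4) := by
      refine eval_mono p ?_
      simp only [size_pair]
      linarith [hl.1]
    refine (Runs.loop_step ?_ (S' := mk (enc (f x y z) ++ m) (enc x ++ a)
      (l.flatMap enc ++ Γ'.ket :: b) t c)
      (N := 20 * Q + 10 * R + 10 * size x + 59 + p.eval (size x + Q + R + 4)) ?_ h1).congr rfl ?_
    · rw [mk_b, List.flatMap_cons, List.append_assoc]
      exact decide_eq_true ((isObj z).head_ne_ket _)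
    · simp only [List.flatMap_cons, List.append_assoc]
      have h3 : Runs P (mk (Γ'.bra :: (enc x ++ Γ'.bra :: (enc y ++ (enc z ++
          Γ'.ket :: Γ'.ket :: m)))) (enc x ++ a) (l.flatMap enc ++ Γ'.ket :: b) t c)
          (mk (enc (f x y z) ++ m) (enc x ++ a) (l.flatMap enc ++ Γ'.ket :: b) t c)
          (p.eval (size (x, y, z))) := by
        simpa [enc_pair] using hP (x, y, z) m (enc x ++ a) (l.flatMap enc ++ Γ'.ket :: b) t c
      refine ((runs_mv_m_a (isObj _)).seq <| runs_push_m.seq <| runs_push_m.seq <|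
        (runs_mv_b_m (isObj _)).seq <| (runs_mv_a_m (isObj _)).seq <| runs_push_m.seq <|
        (runs_dup_a_m (isObj _)).seq <| runs_push_m.seq h3).mono ?_
      have := hl.1
      simp only [size] at *
      omega
    · rw [List.length_cons, add_mul]
      linarith

namespace Poly

theorem foldl {f : α → γ → β → γ} {init : α → γ} {l : α → List β}
    (hf : Poly (fun p : α × γ × β => f p.1 p.2.1 p.2.2)) (hi : Poly init) (hl : Poly l)
    (hb : ∃ q : Polynomial ℕ, ∀ x n,
      size (((l x).take n).foldl (f x) (init x)) ≤ q.eval (size x)) :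
    Poly (fun x => (l x).foldl (f x) (init x)) := by
  obtain ⟨q, hq⟩ := hb
  obtain ⟨r, hr⟩ := hl.polySize
  obtain ⟨P, p, hP⟩ := hf
  obtain ⟨Pi, pi, hi⟩ := hi
  obtain ⟨Pl, pl, hl⟩ := hl
  refine ⟨(mv .m [.m, .a]).seq <| Pl.seq <| (mv .m [.b]).seq <| (pop .b fun _ => skip).seq <|
    (mv .a [.m, .a]).seq <| Pi.seq <| (foldLoop P).seq <| (pop .b fun _ => skip).seq (mv .a []),
    40 * .X + pl + pi + 20 * r + 100 +
      r * (20 * q + 10 * r + 10 * .X + 60 + p.comp (.X + q + r + 4)),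
    fun x m a b t c => ?_⟩
  have h1 := runs_foldLoop hP (x := x) (Q := q.eval (size x)) (R := r.eval (size x)) (l := l x)
    (y := init x) (fun z hz => (size_le_of_mem hz).trans (hr x)) (hq x) m a b t c
  refine ((runs_dup_m_a (isObj x)).seq <| (hl x _ _ _ _ _).seq <| (runs_mv_m_b (isObj _)).seq <|
    Runs.seq (S' := mk m (enc x ++ a) ((l x).flatMap enc ++ Γ'.ket :: b) t c) (N := 2) ?_ <|
    (runs_dup_a_m (isObj _)).seq <| (hi x _ _ _ _ _).seq <| h1.seq <|
    runs_pop_b.seq (runs_drop_a (isObj _))).mono ?_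
  · simp only [enc_list, List.cons_append, List.append_assoc, List.nil_append]
    exact runs_pop_b
  · have h2 := hr x
    have h3 := Nat.mul_le_mul_right (20 * q.eval (size x) + 10 * r.eval (size x) + 10 * size x +
      60 + p.eval (size x + q.eval (size x) + r.eval (size x) + 4))
      ((length_le_size (l x)).trans h2)
    simp only [Polynomial.eval_add, Polynomial.eval_mul, Polynomial.eval_comp,
      Polynomial.eval_ofNat, Polynomial.eval_X]
    simp only [size] at *
    linarith

end Poly

end

end StackProg

/-! ## Arithmetic in binary -/

namespace StackProg

open Computability Turing Prog Function
open Obj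

/-- The number with given binary digits, least significant digit first. -/
def val : List Bool → ℕ
  | [] => 0
  | x :: l => Nat.bit x (val l)

theorem encodeNum_bit1 (n : Num) : encodeNum n.bit1 = true :: encodeNum n := by
  cases n <;> rfl

theorem encodeNum_bit0 {n : Num} (hn : n ≠ 0) : encodeNum n.bit0 = false :: encodeNum n := by
  cases n with
  | zero => exact absurd rfl hn
  | pos p => rfl

theorem encodeNat_eq_bits (n : ℕ) : encodeNat n = n.bits := by
  induction n using Nat.binaryRec' with
  | zero => simp [encodeNat]; rfl
  | bit b n h ih =>
    rw [Nat.bits_append_bit _ _ h, ← ih, encodeNat, encodeNat, ← Num.ofNat'_eq, Num.ofNat'_bit,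
      Num.ofNat'_eq]
    cases b with
    | true => exact encodeNum_bit1 _
    | false =>
      refine encodeNum_bit0 fun h0 => ?_
      have : n ≠ 0 := fun h1 => by simpa using h h1
      exact this (by exact_mod_cast h0)

theorem val_bits (n : ℕ) : val n.bits = n := by
  induction n using Nat.binaryRec' with
  | zero => simp [val]
  | bit b n h ih => rw [Nat.bits_append_bit _ _ h, val, ih]

theorem val_append_true_ne_zero (l : List Bool) : val (l ++ [true]) ≠ 0 := by
  induction l with
  | nil => simp [val]
  | cons x l ih => simp [val, ih]

theorem bits_val (l : List Bool) : (val l).bits = l.rdropWhile (fun x => !x) := by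
  induction l using List.reverseRecOn with
  | nil => simp [val]
  | append_singleton l x ih =>
    cases x with
    | false =>
      rw [List.rdropWhile_concat_pos _ _ _ (by rfl), ← ih]
      congr 1
      clear ih
      induction l with
      | nil => simp [val]
      | cons x l ih => simp [val, ih]
    | true =>
      rw [List.rdropWhile_concat_neg _ _ _ (by simp)]
      clear ih
      induction l with
      | nil => simp [val]
      | cons x l ih =>
        rw [List.cons_append, val, Nat.bits_append_bit _ _ fun h =>
          absurd h (val_append_true_ne_zero l), ih]

/-- Digitwise computation with a carry: `o` gives the next digit, `co` the next carry. -/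
def digits (o co : Bool → Bool → Bool → Bool) : Bool → List Bool → List Bool → List Bool × Bool
  | k, [], [] => ([], k)
  | k, u :: xs, [] => let r := digits o co (co u false k) xs []; (o u false k :: r.1, r.2)
  | k, [], v :: ys => let r := digits o co (co false v k) [] ys; (o false v k :: r.1, r.2)
  | k, u :: xs, v :: ys => let r := digits o co (co u v k) xs ys; (o u v k :: r.1, r.2)

/-- One step of a digitwise computation. -/
def digitStep (o co : Bool → Bool → Bool → Bool) (fin : Bool → Prog) : Prog :=
  pop .c fun k => pop .a fun x => pop .m fun y =>
    match k, x, y with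
    | some (Γ'.bit k), some Γ'.comma, some Γ'.comma => (fin k).seq (push .c Γ'.comma)
    | some (Γ'.bit k), some (Γ'.bit u), some Γ'.comma => (push .m Γ'.comma).seq <|
        (push .t (Γ'.bit (o u false k))).seq (push .c (Γ'.bit (co u false k)))
    | some (Γ'.bit k), some Γ'.comma, some (Γ'.bit v) => (push .a Γ'.comma).seq <|
        (push .t (Γ'.bit (o false v k))).seq (push .c (Γ'.bit (co false v k)))
    | some (Γ'.bit k), some (Γ'.bit u), some (Γ'.bit v) =>
        (push .t (Γ'.bit (o u v k))).seq (push .c (Γ'.bit (co u v k)))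
    | _, _, _ => skip

/-- The loop of a digitwise computation. -/
def digitLoop (o co : Bool → Bool → Bool → Bool) (fin : Bool → Prog) : Prog :=
  loop .c (fun o => o ≠ some Γ'.comma) (digitStep o co fin)

section

variable {o co : Bool → Bool → Bool → Bool} {fin : Bool → Prog} {g : Bool → List Bool → List Bool}

theorem runs_digitLoop (hfin : ∀ k D m a b t c,
      Runs (fin k) (mk m a b (D.map Γ'.bit ++ Γ'.blank :: t) c)
        (mk m a b ((g k D).map Γ'.bit ++ Γ'.blank :: t) c) (3 * D.length + 3))
    (k : Bool) (xs ys D : List Bool) (m a b t c : List Γ') :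
    Runs (digitLoop o co fin)
      (mk (ys.map Γ'.bit ++ Γ'.comma :: m) (xs.map Γ'.bit ++ Γ'.comma :: a) b
        (D.map Γ'.bit ++ Γ'.blank :: t) (Γ'.bit k :: c))
      (mk m a b ((g (digits o co k xs ys).2 ((digits o co k xs ys).1.reverse ++ D)).map Γ'.bit ++
        Γ'.blank :: t) (Γ'.comma :: c))
      (10 * (xs.length + ys.length) + 3 * D.length + 12) := by
  fun_induction digits o co k xs ys generalizing D with
  | case1 k =>
    refine (Runs.loop_step (S' := mk m a b ((g k D).map Γ'.bit ++ Γ'.blank :: t) (Γ'.comma :: c))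
      (N := 3 * D.length + 7) (by simp) ?_ (Runs.loop_done (by simp))).congr (by simp) (by simp)
    refine Runs.pop (Runs.pop (Runs.pop ?_))
    simp only [mk_m, mk_a, mk_c, update_mk_m, update_mk_a, update_mk_c, List.map_nil,
      List.nil_append, List.head?_cons, List.tail_cons]
    exact (hfin k D m a b t c).seq (Runs.push.congr (by simp) le_rfl)
  | case2 k u xs r ih =>
    refine (Runs.loop_step (N := 6) (by simp) ?_ (ih (o u false k :: D))).congr (by simp [r])
      (by simp; omega)
    refine Runs.pop (Runs.pop (Runs.pop ?_))
    simp only [mk_m, mk_a, mk_c, update_mk_m, update_mk_a, update_mk_c, List.map_nil,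
      List.nil_append, List.head?_cons, List.tail_cons, List.map_cons, List.cons_append]
    exact Runs.push.seq (Runs.push.seq (Runs.push.congr (by simp) le_rfl))
  | case3 k v ys r ih =>
    refine (Runs.loop_step (N := 6) (by simp) ?_ (ih (o false v k :: D))).congr (by simp [r])
      (by simp; omega)
    refine Runs.pop (Runs.pop (Runs.pop ?_))
    simp only [mk_m, mk_a, mk_c, update_mk_m, update_mk_a, update_mk_c, List.map_nil,
      List.nil_append, List.head?_cons, List.tail_cons, List.map_cons, List.cons_append]
    exact Runs.push.seq (Runs.push.seq (Runs.push.congr (by simp) le_rfl))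
  | case4 k u xs v ys r ih =>
    refine (Runs.loop_step (N := 6) (by simp) ?_ (ih (o u v k :: D))).congr (by simp [r])
      (by simp; omega)
    refine Runs.pop (Runs.pop (Runs.pop ?_))
    simp only [mk_m, mk_a, mk_c, update_mk_m, update_mk_a, update_mk_c,
      List.head?_cons, List.tail_cons, List.map_cons, List.cons_append]
    exact (Runs.push.seq (Runs.push.congr (by simp) le_rfl)).mono (by omega)

/-- Remove leading zeros (on top of the transfer stack). -/
def strip : Prog := loop .t (fun o => o = some (Γ'.bit false)) (pop .t fun _ => skip)

theorem runs_strip (D : List Bool) (m a b t c : List Γ') :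
    Runs strip (mk m a b (D.map Γ'.bit ++ Γ'.blank :: t) c)
      (mk m a b ((D.dropWhile (fun x => !x)).map Γ'.bit ++ Γ'.blank :: t) c)
      (3 * D.length + 1) := by
  induction D with
  | nil => exact Runs.loop_done (by simp)
  | cons x D ih =>
    cases x with
    | true => exact (Runs.loop_done (by simp)).congr (by simp) (by simp)
    | false =>
      refine (Runs.loop_step (by simp) (Runs.pop (Runs.skip.congr (S'' := mk m a b
        (D.map Γ'.bit ++ Γ'.blank :: t) c) (by simp) le_rfl)) ih).congr (by simp) ?_
      simp
      omega

theorem enc_nat (n : ℕ) : enc n = n.bits.map Γ'.bit ++ [Γ'.comma] := by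
  rw [← encodeNat_eq_bits]
  rfl

theorem digits_length (k : Bool) (xs ys : List Bool) :
    (digits o co k xs ys).1.length ≤ xs.length + ys.length := by
  fun_induction digits o co k xs ys with
  | case1 => simp
  | case2 _ _ _ r ih | case3 _ _ _ r ih | case4 _ _ _ _ _ r ih =>
    simp only [r, List.length_cons] at ih ⊢
    omega

theorem poly_digits {h : ℕ → ℕ → ℕ} (hfin : ∀ k D m a b t c,
      Runs (fin k) (mk m a b (D.map Γ'.bit ++ Γ'.blank :: t) c)
        (mk m a b ((g k D).map Γ'.bit ++ Γ'.blank :: t) c) (3 * D.length + 3))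
    (hg : ∀ k D, (g k D).length ≤ D.length + 1)
    (hh : ∀ xs ys, val (g (digits o co false xs ys).2
      (digits o co false xs ys).1.reverse).reverse = h (val xs) (val ys)) :
    Poly (fun x : ℕ × ℕ => h x.1 x.2) := by
  refine ⟨(pop .m fun _ => skip).seq <| (mv .m [.a]).seq <| (push .t Γ'.blank).seq <|
    (push .c (Γ'.bit false)).seq <| (digitLoop o co fin).seq <| (pop .c fun _ => skip).seq <|
    strip.seq <| (pop .m fun _ => skip).seq <| (push .m Γ'.comma).seq <| put [.m],
    100 * .X + 100, fun ⟨x, y⟩ m a b t c => ?_⟩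
  have e1 : size (x, y) = x.bits.length + y.bits.length + 4 := by
    rw [size_pair, size, size, enc_nat, enc_nat]
    simp; omega
  have e2 := digits_length (o := o) (co := co) false x.bits y.bits
  have h1 := runs_digitLoop (o := o) (co := co) hfin false x.bits y.bits [] (Γ'.ket :: m) a b t c
  have hD := hh x.bits y.bits
  have e3 := hg (digits o co false x.bits y.bits).2 (digits o co false x.bits y.bits).1.reverse
  rw [List.append_nil] at h1
  set D := g (digits o co false x.bits y.bits).2 (digits o co false x.bits y.bits).1.reverse
    with hDdef
  rw [val_bits, val_bits] at hD
  have h2 : (h x y).bits = (D.dropWhile (fun x => !x)).reverse := by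
    rw [← hD, bits_val, List.rdropWhile, List.reverse_reverse]
  have e4 : (D.dropWhile (fun x => !x)).length ≤ D.length := (List.dropWhile_sublist _).length_le
  have h3 := runs_put (ks := [.m]) (by simp) (by simp)
    (o := (D.dropWhile (fun x => !x)).map Γ'.bit) (t := t) (by simp)
    (mk (Γ'.comma :: m) a b ((D.dropWhile (fun x => !x)).map Γ'.bit ++ Γ'.blank :: t) c) rfl
  have h4 : Runs (pop .c fun _ => skip)
      (mk (Γ'.ket :: m) a b (D.map Γ'.bit ++ Γ'.blank :: t) (Γ'.comma :: c))
      (mk (Γ'.ket :: m) a b (D.map Γ'.bit ++ Γ'.blank :: t) c) 2 :=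
    Runs.pop (Runs.skip.congr (by simp) le_rfl)
  have h5 : Runs (push .t Γ'.blank) (mk (y.bits.map Γ'.bit ++ Γ'.comma :: Γ'.ket :: m)
      (x.bits.map Γ'.bit ++ Γ'.comma :: a) b t c) (mk (y.bits.map Γ'.bit ++ Γ'.comma ::
      Γ'.ket :: m) (x.bits.map Γ'.bit ++ Γ'.comma :: a) b (Γ'.blank :: t) c) 1 :=
    Runs.push.congr (by simp) le_rfl
  have h6 : Runs (push .c (Γ'.bit false)) (mk (y.bits.map Γ'.bit ++ Γ'.comma :: Γ'.ket :: m)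
      (x.bits.map Γ'.bit ++ Γ'.comma :: a) b (Γ'.blank :: t) c) (mk (y.bits.map Γ'.bit ++
      Γ'.comma :: Γ'.ket :: m) (x.bits.map Γ'.bit ++ Γ'.comma :: a) b (Γ'.blank :: t)
      (Γ'.bit false :: c)) 1 :=
    Runs.push.congr (by simp) le_rfl
  have h7 : Runs ((pop .m fun _ => skip).seq (mv .m [.a])) (mk (enc (x, y) ++ m) a b t c)
      (mk (y.bits.map Γ'.bit ++ Γ'.comma :: Γ'.ket :: m)
      (x.bits.map Γ'.bit ++ Γ'.comma :: a) b t c) (2 + (10 * size x + 13)) := by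
    have := (runs_pop_m (x := Γ'.bra) (m := enc x ++ (enc y ++ Γ'.ket :: m)) (a := a) (b := b)
      (t := t) (c := c)).seq (runs_mv_m_a (isObj x))
    simpa [enc_pair, enc_nat y, size, enc_nat x] using this
  obtain ⟨n7, hn7, h7⟩ := h7
  cases h7 with
  | @seq _ _ _ S1 _ n n' h7 h7' =>
  refine (Runs.seq (N := n) ⟨n, le_rfl, h7⟩ <| Runs.seq (N := n') ⟨n', le_rfl, h7'⟩ <|
    h5.seq <| h6.seq <| h1.seq <| h4.seq <| (runs_strip D _ _ _ _ _).seq <| runs_pop_m.seq <|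
    runs_push_m.seq h3).congr ?_ ?_
  · funext j
    cases j <;> simp [addTo, enc_nat, h2]
  · have : size x = x.bits.length + 1 := by rw [size, enc_nat]; simp
    simp [e1] at *
    omega

end

namespace Poly

theorem addPair : Poly (fun x : ℕ × ℕ => x.1 + x.2) := by
  refine poly_digits (o := fun u v k => (u ^^ v) ^^ k)
    (co := fun u v k => (u && v) || (k && (u || v))) (fin := fun k => push .t (Γ'.bit k))
    (g := fun k D => k :: D) (h := fun x y => x + y) ?_ (fun _ _ => by simp) fun xs ys => ?_
  · intro k D m a b t c
    exact Runs.push.congr (by simp) (by omega)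
  · have key : ∀ k xs ys, val ((digits (fun u v k => (u ^^ v) ^^ k)
        (fun u v k => (u && v) || (k && (u || v))) k xs ys).1 ++ [(digits (fun u v k => (u ^^ v) ^^ k)
        (fun u v k => (u && v) || (k && (u || v))) k xs ys).2]) = val xs + val ys + k.toNat := by
      intro k xs ys
      fun_induction digits (fun u v k => (u ^^ v) ^^ k)
        (fun u v k => (u && v) || (k && (u || v))) k xs ys with
      | case1 k => cases k <;> simp [val]
      | case2 k u xs r ih =>
        simp only [List.cons_append, val, r, ih]
        cases k <;> cases u <;> simp [Nat.bit] <;> omega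
      | case3 k u xs r ih =>
        simp only [List.cons_append, val, r, ih]
        cases k <;> cases u <;> simp [Nat.bit] <;> omega
      | case4 k u xs v ys r ih =>
        simp only [List.cons_append, val, r, ih]
        cases k <;> cases u <;> cases v <;> simp [Nat.bit] <;> omega
    simpa using key false xs ys

theorem subPair : Poly (fun x : ℕ × ℕ => x.1 - x.2) := by
  refine poly_digits (o := fun u v k => (u ^^ v) ^^ k)
    (co := fun u v k => if u then v && k else v || k)
    (fin := fun k => if k then loop .t (fun o => o ≠ some Γ'.blank) (pop .t fun _ => skip) else skip)
    (g := fun k D => if k then [] else D) (h := fun x y => x - y) ?_ ?_ fun xs ys => ?_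
  · intro k D m a b t c
    cases k with
    | false => exact Runs.skip.mono (by omega)
    | true =>
      induction D with
      | nil => exact (Runs.loop_done (by simp)).mono (by omega)
      | cons x D ih =>
        refine (Runs.loop_step (by simp) (Runs.pop (Runs.skip.congr (S'' := mk m a b
          (D.map Γ'.bit ++ Γ'.blank :: t) c) (by simp) le_rfl)) ih).congr (by simp) ?_
        simp
        omega
  · intro k D
    cases k <;> simp
  · have key : ∀ k xs ys, ∀ r, digits (fun u v k => (u ^^ v) ^^ k)
        (fun u v k => if u then v && k else v || k) k xs ys = r → ∃ n,
        val r.1 < n ∧ val r.1 + val ys + k.toNat = val xs + n * r.2.toNat := by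
      intro k xs ys
      fun_induction digits (fun u v k => (u ^^ v) ^^ k)
        (fun u v k => if u then v && k else v || k) k xs ys with
      | case1 k =>
        rintro _ rfl
        exact ⟨1, by cases k <;> simp [val]⟩
      | case2 k u xs r ih =>
        rintro _ rfl
        obtain ⟨n, h1, h2⟩ := ih r rfl
        refine ⟨2 * n, ?_⟩
        generalize r.2 = k' at *
        simp only [val] at *
        cases k <;> cases u <;> cases k' <;> simp [Nat.bit] at * <;> omega
      | case3 k u xs r ih =>
        rintro _ rfl
        obtain ⟨n, h1, h2⟩ := ih r rfl
        refine ⟨2 * n, ?_⟩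
        generalize r.2 = k' at *
        simp only [val] at *
        cases k <;> cases u <;> cases k' <;> simp [Nat.bit] at * <;> omega
      | case4 k u xs v ys r ih =>
        rintro _ rfl
        obtain ⟨n, h1, h2⟩ := ih r rfl
        refine ⟨2 * n, ?_⟩
        generalize r.2 = k' at *
        simp only [val] at *
        cases k <;> cases u <;> cases v <;> cases k' <;> simp [Nat.bit] at * <;> omega
    obtain ⟨n, h1, h2⟩ := key false xs ys _ rfl
    generalize digits (fun u v k => (u ^^ v) ^^ k)
        (fun u v k => if u then v && k else v || k) false xs ys = r at *
    obtain ⟨D, k⟩ := r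
    cases k <;> simp [val] at * <;> omega

section

variable {α β γ δ : Type} [Obj α] [Obj β] [Obj γ] [Obj δ]

theorem add {f g : α → ℕ} (hf : Poly f) (hg : Poly g) : Poly (fun x => f x + g x) :=
  comp (f := fun x => (f x, g x)) addPair (hf.pair hg)

theorem sub {f g : α → ℕ} (hf : Poly f) (hg : Poly g) : Poly (fun x => f x - g x) :=
  comp (f := fun x => (f x, g x)) subPair (hf.pair hg)

theorem ite_le {n n' : α → ℕ} {f g : α → β} (hn : Poly n) (hn' : Poly n') (hf : Poly f)
    (hg : Poly g) : Poly (fun x => if n x ≤ n' x then f x else g x) := by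
  simpa only [Nat.sub_eq_zero_iff_le] using (hn.sub hn').ite_zero hf hg

theorem ite_eq {n n' : α → ℕ} {f g : α → β} (hn : Poly n) (hn' : Poly n') (hf : Poly f)
    (hg : Poly g) : Poly (fun x => if n x = n' x then f x else g x) := by
  have : ∀ x, (n x - n' x) + (n' x - n x) = 0 ↔ n x = n' x := fun x => by omega
  simpa only [this] using ((hn.sub hn').add (hn'.sub hn)).ite_zero hf hg

theorem max {f g : α → ℕ} (hf : Poly f) (hg : Poly g) : Poly (fun x => Max.max (f x) (g x)) := by
  have : ∀ x, Max.max (f x) (g x) = f x + (g x - f x) := fun x => by omega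
  simpa only [this] using hf.add (hg.sub hf)

theorem min {f g : α → ℕ} (hf : Poly f) (hg : Poly g) : Poly (fun x => Min.min (f x) (g x)) := by
  have : ∀ x, Min.min (f x) (g x) = f x - (f x - g x) := fun x => by omega
  simpa only [this] using hf.sub (hf.sub hg)

end

end Poly

end StackProg

/-! ## Polynomial time functions on lists -/

namespace StackProg

open Obj

theorem size_nat (n : ℕ) : size n = n.size + 1 := by
  rw [size, enc_nat]
  simp [Nat.size_eq_bits_len]

theorem size_nat_le (n : ℕ) : size n ≤ n + 1 := by
  rw [size_nat]
  exact Nat.succ_le_succ (Nat.size_le.2 Nat.lt_two_pow_self)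

theorem size_mul_le (m n : ℕ) : size (m * n) ≤ m + size n := by
  rw [size_nat, size_nat]
  refine Nat.succ_le_succ (Nat.size_le.2 ?_)
  change m * n < 2 ^ (m + n.size)
  rw [pow_add]
  exact Nat.mul_lt_mul'' Nat.lt_two_pow_self (Nat.lt_size_self n)

section

variable {α β γ δ : Type} [Obj α] [Obj β] [Obj γ] [Obj δ]

theorem size_append (l l' : List α) : size (l ++ l') + 2 = size l + size l' := by
  induction l with
  | nil => simp [add_comm]
  | cons x l ih =>
    rw [List.cons_append, size_cons, size_cons]
    omega

theorem size_reverse (l : List α) : size l.reverse = size l := by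
  induction l with
  | nil => rfl
  | cons x l ih =>
    have := size_append l.reverse [x]
    rw [size_cons, size_nil] at this
    rw [List.reverse_cons, size_cons]
    omega

theorem size_take_le (l : List α) (n : ℕ) : size (l.take n) ≤ size l := by
  have := size_append (l.take n) (l.drop n)
  rw [List.take_append_drop] at this
  have : 2 ≤ size (l.drop n) := by simp [size, enc_list]
  omega

namespace Poly

theorem reverse {l : α → List β} (hl : Poly l) : Poly (fun x => (l x).reverse) := by
  have := foldl (f := fun (_ : α) (y : List β) z => z :: y) (init := fun _ => [])
    (cons (comp snd snd) (comp fst snd)) (const _) hl ?_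
  · simpa using this
  · obtain ⟨r, hr⟩ := hl.polySize
    refine ⟨r, fun x n => ?_⟩
    simpa [size_reverse] using (size_take_le _ _).trans (hr x)

theorem map {f : α → β → γ} {l : α → List β} (hf : Poly (fun p : α × β => f p.1 p.2))
    (hl : Poly l) : Poly (fun x => (l x).map (f x)) := by
  have := reverse (foldl (f := fun x (y : List γ) z => f x z :: y) (init := fun _ => [])
    (cons (comp (f := fun p : α × List γ × β => (p.1, p.2.2)) hf (pair fst (comp snd snd)))
    (comp fst snd)) (const _) hl ?_)
  · have e : ∀ x, (List.foldl (fun (y : List γ) z => f x z :: y) [] (l x)).reverse =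
        (l x).map (f x) := fun x => by
      rw [← List.foldl_map (f := f x) (g := fun (y : List γ) z => z :: y)]
      simp
    simpa only [e] using this
  · obtain ⟨r, hr⟩ := hl.polySize
    obtain ⟨p, hp⟩ := hf.polySize
    refine ⟨r * p.comp (.X + r + 2) + 2, fun x n => ?_⟩
    rw [← List.foldl_map (f := f x) (g := fun (y : List γ) z => z :: y)]
    simp only [List.foldl_flip_cons_eq_append, List.append_nil, size_reverse, Polynomial.eval_add,
      Polynomial.eval_mul, Polynomial.eval_comp, Polynomial.eval_X, Polynomial.eval_ofNat]
    refine (size_le_of_forall (B := p.eval (size x + r.eval (size x) + 2)) ?_).trans ?_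
    · simp only [List.mem_map, forall_exists_index, and_imp, forall_apply_eq_imp_iff₂]
      intro z hz
      refine (hp (x, z)).trans (eval_mono p ?_)
      rw [size_pair]
      have := (size_le_of_mem (List.mem_of_mem_take hz)).trans (hr x)
      omega
    · gcongr
      refine le_trans ?_ ((length_le_size _).trans (hr x))
      simp

theorem append {l l' : α → List β} (hl : Poly l) (hl' : Poly l') :
    Poly (fun x => l x ++ l' x) := by
  have := foldl (f := fun (_ : α) (y : List β) z => z :: y)
    (cons (comp snd snd) (comp fst snd)) hl' hl.reverse ?_
  · simpa using this
  · obtain ⟨r, hr⟩ := hl.polySize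
    obtain ⟨r', hr'⟩ := hl'.polySize
    refine ⟨r + r', fun x n => ?_⟩
    have h1 := size_append ((l x).reverse.take n).reverse (l' x)
    have h2 := size_take_le (l x).reverse n
    have h3 := hr x
    have h4 := hr' x
    rw [size_reverse] at h1 h2
    simp at *
    omega

theorem flatMap {f : α → β → List γ} {l : α → List β} (hf : Poly (fun p : α × β => f p.1 p.2))
    (hl : Poly l) : Poly (fun x => (l x).flatMap (f x)) := by
  have := foldl (f := fun x (y : List γ) z => y ++ f x z) (init := fun _ => [])
    (append (comp fst snd) (comp (f := fun p : α × List γ × β => (p.1, p.2.2)) hf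
      (pair fst (comp snd snd)))) (const _) hl ?_
  · simpa only [List.flatMap_eq_foldl] using this
  · obtain ⟨r, hr⟩ := hl.polySize
    obtain ⟨p, hp⟩ := hf.polySize
    refine ⟨r * p.comp (.X + r + 2) + 2, fun x n => ?_⟩
    rw [← List.flatMap_eq_foldl]
    have key : ∀ (B : ℕ) (l : List β), (∀ z ∈ l, size (f x z) ≤ B) →
        size (l.flatMap (f x)) ≤ l.length * B + 2 := by
      intro B l
      induction l with
      | nil => simp
      | cons z l ih =>
        intro h
        simp only [List.mem_cons, forall_eq_or_imp] at h
        have h1 := ih h.2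
        have h2 := size_append (f x z) (l.flatMap (f x))
        rw [List.flatMap_cons, List.length_cons, add_mul]
        omega
    simp only [Polynomial.eval_add,
      Polynomial.eval_mul, Polynomial.eval_comp, Polynomial.eval_X, Polynomial.eval_ofNat]
    refine (key (p.eval (size x + r.eval (size x) + 2)) _ ?_).trans ?_
    · intro z hz
      refine (hp (x, z)).trans (eval_mono p ?_)
      rw [size_pair]
      have := (size_le_of_mem (List.mem_of_mem_take hz)).trans (hr x)
      omega
    · gcongr
      refine le_trans ?_ ((length_le_size _).trans (hr x))
      simp

theorem length_mul {l : α → List β} {n : α → ℕ} (hl : Poly l) (hn : Poly n) :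
    Poly (fun x => (l x).length * n x) := by
  have e : ∀ (x : α) (l : List β) (k : ℕ), l.foldl (fun (y : ℕ) _ => y + n x) k =
      k + l.length * n x := by
    intro x l
    induction l with
    | nil => simp
    | cons z l ih => intro k; simp only [List.foldl_cons, ih, List.length_cons]; ring
  have := foldl (f := fun x (y : ℕ) (_ : β) => y + n x) (init := fun _ => 0)
    (add (comp fst snd) (comp hn fst)) (const _) hl ?_
  · simpa only [e, zero_add] using this
  · obtain ⟨r, hr⟩ := hl.polySize
    obtain ⟨p, hp⟩ := hn.polySize
    refine ⟨r + p, fun x m => ?_⟩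
    have h1 := (length_le_size (l x)).trans (hr x)
    rw [e, zero_add, Polynomial.eval_add]
    refine (size_mul_le _ _).trans (add_le_add ?_ (hp x))
    simp
    omega

theorem length {l : α → List β} (hl : Poly l) : Poly (fun x => (l x).length) := by
  simpa using hl.length_mul (const 1)

theorem const_mul {f : α → ℕ} (c : ℕ) (hf : Poly f) : Poly (fun x => c * f x) := by
  simpa using length_mul (const (List.range c)) hf

/-- The list of the indices of a list. -/
theorem range_length {l : α → List β} (hl : Poly l) : Poly (fun x => List.range (l x).length) := by
  have e : ∀ (l : List β), l.foldl (fun (y : List ℕ) _ => y.length :: y) [] =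
      (List.range l.length).reverse := by
    intro l
    induction l using List.reverseRecOn with
    | nil => rfl
    | append_singleton l z ih => simp [ih, List.range_succ]
  have := reverse (foldl (f := fun (_ : α) (y : List ℕ) (_ : β) => y.length :: y)
    (init := fun _ => []) (cons (length (comp fst snd)) (comp fst snd)) (const _) hl ?_)
  · simpa only [e, List.reverse_reverse] using this
  · obtain ⟨r, hr⟩ := hl.polySize
    refine ⟨r * (r + 1) + 2, fun x n => ?_⟩
    have h1 := (length_le_size (l x)).trans (hr x)
    rw [e, size_reverse]
    refine (size_le_of_forall (B := r.eval (size x) + 1) ?_).trans ?_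
    · intro z hz
      refine (size_nat_le z).trans ?_
      simp at hz
      omega
    · simp only [Polynomial.eval_add, Polynomial.eval_mul, Polynomial.eval_one,
        Polynomial.eval_ofNat]
      gcongr
      simp
      omega

theorem getD {l : α → List β} {n : α → ℕ} (hl : Poly l) (hn : Poly n) (d : β) :
    Poly (fun x => (l x).getD (n x) d) := by
  have e : ∀ (n : ℕ) (l : List β) (j : ℕ) (r : β),
      l.foldl (fun (y : ℕ × β) z => (y.1 + 1, if y.1 = n then z else y.2)) (j, r) =
      (j + l.length, if j ≤ n ∧ n < j + l.length then l.getD (n - j) d else r) := by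
    intro n l
    induction l with
    | nil => simp
    | cons z l ih =>
      intro j r
      rw [List.foldl_cons, ih]
      refine Prod.ext (by simp; omega) ?_
      simp only [List.length_cons]
      rcases lt_trichotomy j n with h | rfl | h
      · obtain ⟨k, rfl⟩ : ∃ k, n = j + 1 + k := ⟨n - (j + 1), by omega⟩
        have e1 : j + 1 + k - (j + 1) = k := by omega
        have e2 : j + 1 + k - j = k + 1 := by omega
        rw [e1, e2, List.getD_cons_succ]
        simp only [h.ne, if_false]
        congr 1
        simp only [eq_iff_iff]
        omega
      · simp
      · rw [if_neg (by omega), if_neg (by omega), if_neg (by omega)]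
  have := comp snd (foldl (f := fun x (y : ℕ × β) z => (y.1 + 1, if y.1 = n x then z else y.2))
    (init := fun _ => (0, d)) (pair (add (comp fst (comp fst snd)) (const 1))
      (ite_eq (comp fst (comp fst snd)) (comp hn fst) (comp snd snd) (comp snd (comp fst snd))))
      (const _) hl ?_)
  · have e' : ∀ x, (if 0 ≤ n x ∧ n x < 0 + (l x).length then (l x).getD (n x - 0) d else d) =
        (l x).getD (n x) d := by
      intro x
      split_ifs with h
      · rfl
      · rw [List.getD_eq_default]
        omega
    simpa only [e, e'] using this
  · obtain ⟨r, hr⟩ := hl.polySize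
    refine ⟨2 * r + .C (size d) + 3, fun x m => ?_⟩
    have h1 := (length_le_size (l x)).trans (hr x)
    rw [e, size_pair]
    have h2 : size (0 + ((l x).take m).length) ≤ r.eval (size x) + 1 := by
      refine (size_nat_le _).trans ?_
      simp
      omega
    have h3 : size (if 0 ≤ n x ∧ n x < 0 + ((l x).take m).length then
        ((l x).take m).getD (n x - 0) d else d) ≤ r.eval (size x) + size d := by
      split_ifs with h
      · rw [List.getD_eq_getElem _ _ (by simpa using h)]
        have := (size_le_of_mem (List.mem_of_mem_take (List.getElem_mem
          (show n x - 0 < ((l x).take m).length by simpa using h)))).trans (hr x)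
        omega
      · omega
    simp only [Polynomial.eval_add, Polynomial.eval_mul, Polynomial.eval_C,
      Polynomial.eval_ofNat]
    omega

theorem maximum {l : α → List ℕ} (hl : Poly l) : Poly (fun x => (l x).foldl Max.max 0) := by
  refine foldl (f := fun _ y z => Max.max y z) (max (comp fst snd) (comp snd snd)) (const 0) hl ?_
  have key : ∀ (l : List ℕ) (k : ℕ), l.foldl Max.max k ∈ k :: l := by
    intro l
    induction l with
    | nil => simp
    | cons z l ih =>
      intro k
      have := ih (Max.max k z)
      rcases max_choice k z with h | h <;> rw [List.foldl_cons] <;> rw [h] at this ⊢ <;>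
        simp only [List.mem_cons] at this ⊢ <;> tauto
  obtain ⟨r, hr⟩ := hl.polySize
  refine ⟨r + 1, fun x n => ?_⟩
  rw [Polynomial.eval_add, Polynomial.eval_one]
  rcases List.mem_cons.1 (key ((l x).take n) 0) with h | h
  · refine le_trans (le_of_eq (congrArg _ h)) ?_
    have : size 0 = 1 := rfl
    omega
  · exact (size_le_of_mem (List.mem_of_mem_take h)).trans ((hr x).trans (by omega))

end Poly

end

end StackProg

/-! ## The reduction -/

namespace MatchingReduction

open StackProg StackProg.Obj

/-- Pairs of weight matrices. -/
abbrev Mats := List (List ℕ) × List (List ℕ)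

/-- Vertices `(s, b, i)`: the kind `s` is `0` (left end), `1` (right end), `2`, `3`, `4` (first side,
second side and separators in the first half) or `5`, `6`, `7` (the same in the second half); `b`
is `0` or `1` for the first and the second graph; `i` is an index. -/
abbrev Vtx := ℕ × ℕ × ℕ

/-- The weight matrix of one of the graphs. -/
def mat (I : Mats) (b : ℕ) : List (List ℕ) := if b = 0 then I.1 else I.2

/-- The number of vertices on each side. -/
def cnt (I : Mats) (b : ℕ) : ℕ := (mat I b).length

/-- The maximal weight. -/
def wmax (I : Mats) (b : ℕ) : ℕ :=
  ((mat I b).map fun r => r.foldl Max.max 0).foldl Max.max 0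

/-- A bound for the weights of matchings. -/
def slack (I : Mats) (b : ℕ) : ℕ := (mat I b).length * wmax I b

/-- The length scale of the part of the line used for a graph. -/
def scale (I : Mats) (b : ℕ) : ℕ := (mat I b).length * slack I b

/-- The length of the line. -/
def total (I : Mats) : ℕ := 12 * (scale I 0 + scale I 1)

/-- The beginning of the part of the line used for a graph in one of the halves. -/
def base (I : Mats) (s b : ℕ) : ℕ :=
  if s ≤ 4 then if b = 0 then 0 else 6 * scale I 0
  else if b = 0 then 6 * scale I 0 + 12 * scale I 1 else 6 * scale I 0 + 6 * scale I 1

/-- The offset of a kind of vertices. -/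
def shift (I : Mats) (s b : ℕ) : ℕ :=
  if s = 3 then 2 * slack I b else if s = 6 then 2 * slack I b else
  if s = 4 then 4 * slack I b else if s = 7 then 4 * slack I b else 0

/-- A lower bound for the position of a vertex. -/
def lo (I : Mats) (s b : ℕ) : ℕ :=
  if s = 0 then 0 else if s = 1 then total I else base I s b + shift I s b

/-- The freedom of the last vertex of a kind. -/
def room (I : Mats) (s b : ℕ) : ℕ :=
  if s = 4 then if b = 0 then min (slack I 0) (slack I 1) else slack I b
  else if s = 7 then if b = 0 then slack I b else min (slack I 0) (slack I 1) else slack I b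

/-- An upper bound for the position of a vertex. -/
def hi (I : Mats) (s b : ℕ) : ℕ :=
  if s = 0 then 0 else if s = 1 then total I else
    lo I s b + (6 * scale I b - 6 * slack I b) + room I s b

/-- An entry of a weight matrix. -/
def wt (I : Mats) (b i j : ℕ) : ℕ := ((mat I b).getD i []).getD j 0

/-- The weights used in the first half: those of the first graph, and the complements of those of
the second graph. -/
def wt₁ (I : Mats) (b i j : ℕ) : ℕ := if b = 0 then wt I b i j else wmax I b - wt I b i j

/-- The weights used in the second half. -/
def wt₂ (I : Mats) (b i j : ℕ) : ℕ := if b = 0 then wmax I b - wt I b i j else wt I b i j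

/-- The distance between vertices of the same graph with kinds `s` and `t`, other than two ends. -/
def gap (I : Mats) (s t b i j : ℕ) : ℕ :=
  if s = t then if i = j then 0 else 6 * slack I b else
  if s = 2 then
    if t = 3 then 2 * slack I b + wt₁ I b i j
    else if t = 5 then if i = j then lo I t b - lo I s b - slack I b else 0
    else 0 else
  if s = 3 then
    if t = 4 then 2 * slack I b
    else if t = 6 then if i = j then lo I t b - lo I s b - slack I b else 0
    else 0 else
  if s = 4 then if t = 2 then 2 * slack I b else 0 else
  if s = 5 then if t = 6 then 2 * slack I b + wt₂ I b i j else 0 else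
  if s = 6 then if t = 7 then 2 * slack I b else 0 else
  if s = 7 then if t = 5 then 2 * slack I b else 0 else 0

/-- The distance between vertices of different graphs with kinds `s` and `t`, other than two
ends. -/
def link (I : Mats) (s t b : ℕ) : ℕ :=
  if s = 4 then if t = 2 then if b = 0 then 2 * slack I 0 else 0 else 0 else
  if s = 7 then if t = 5 then if b = 0 then 0 else 2 * slack I 1 else 0 else 0

/-- The distance required between two vertices, before symmetrization. -/
def edge (I : Mats) (u v : Vtx) : ℕ :=
  if u.1 = 0 then lo I v.1 v.2.1 else
  if v.1 = 1 then total I - hi I u.1 u.2.1 else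
  if u.2.1 = v.2.1 then gap I u.1 v.1 u.2.1 u.2.2 v.2.2 else link I u.1 v.1 u.2.1

/-- The distance required between two vertices. -/
def dist (I : Mats) (u v : Vtx) : ℕ := max (edge I u v) (edge I v u)

/-- The list of the vertices. -/
def verts (I : Mats) : List Vtx :=
  (List.range 8).flatMap fun s =>
    ((List.range I.1.length).map fun i => (s, 0, i)) ++
      (List.range I.2.length).map fun i => (s, 1, i)

/-- The weight matrix and the span of the resulting instance. -/
def reduce (I : Mats) : List (List ℕ) × ℕ :=
  ((verts I).map fun u => (verts I).map fun v => dist I u v, total I + 1)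

end MatchingReduction

namespace StackProg.Poly

open MatchingReduction

section

variable {α : Type} [Obj α] {f : α → Mats} {b s t i j : α → ℕ}

theorem mat (hf : Poly f) (hb : Poly b) : Poly fun x => mat (f x) (b x) :=
  ite_eq hb (const 0) (fst.comp hf) (snd.comp hf)

theorem wmax (hf : Poly f) (hb : Poly b) : Poly fun x => wmax (f x) (b x) := by
  have h : Poly fun p : α × List ℕ => p.2.foldl Max.max 0 := maximum snd
  have h' : Poly fun x => (MatchingReduction.mat (f x) (b x)).map fun r => r.foldl Max.max 0 :=
    map (f := fun (_ : α) (r : List ℕ) => r.foldl Max.max 0) h (mat hf hb)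
  unfold MatchingReduction.wmax
  exact maximum h'

theorem slack (hf : Poly f) (hb : Poly b) : Poly fun x => slack (f x) (b x) :=
  length_mul (mat hf hb) (wmax hf hb)

theorem scale (hf : Poly f) (hb : Poly b) : Poly fun x => scale (f x) (b x) :=
  length_mul (mat hf hb) (slack hf hb)

theorem total (hf : Poly f) : Poly fun x => total (f x) :=
  const_mul 12 (add (scale hf (const 0)) (scale hf (const 1)))

theorem base (hf : Poly f) (hs : Poly s) (hb : Poly b) : Poly fun x => base (f x) (s x) (b x) :=
  ite_le hs (const 4) (ite_eq hb (const 0) (const 0) (const_mul 6 (scale hf (const 0))))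
    (ite_eq hb (const 0)
      (add (const_mul 6 (scale hf (const 0))) (const_mul 12 (scale hf (const 1))))
      (add (const_mul 6 (scale hf (const 0))) (const_mul 6 (scale hf (const 1)))))

theorem shift (hf : Poly f) (hs : Poly s) (hb : Poly b) : Poly fun x => shift (f x) (s x) (b x) :=
  ite_eq hs (const 3) (const_mul 2 (slack hf hb)) <|
  ite_eq hs (const 6) (const_mul 2 (slack hf hb)) <|
  ite_eq hs (const 4) (const_mul 4 (slack hf hb)) <|
  ite_eq hs (const 7) (const_mul 4 (slack hf hb)) (const 0)

theorem lo (hf : Poly f) (hs : Poly s) (hb : Poly b) : Poly fun x => lo (f x) (s x) (b x) :=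
  ite_eq hs (const 0) (const 0) <| ite_eq hs (const 1) (total hf) <|
    add (base hf hs hb) (shift hf hs hb)

theorem room (hf : Poly f) (hs : Poly s) (hb : Poly b) : Poly fun x => room (f x) (s x) (b x) :=
  have h := min (slack hf (const 0)) (slack hf (const 1))
  ite_eq hs (const 4) (ite_eq hb (const 0) h (slack hf hb)) <|
  ite_eq hs (const 7) (ite_eq hb (const 0) (slack hf hb) h) (slack hf hb)

theorem hi (hf : Poly f) (hs : Poly s) (hb : Poly b) : Poly fun x => hi (f x) (s x) (b x) :=
  ite_eq hs (const 0) (const 0) <| ite_eq hs (const 1) (total hf) <|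
    add (add (lo hf hs hb) (sub (const_mul 6 (scale hf hb)) (const_mul 6 (slack hf hb))))
      (room hf hs hb)

theorem wt (hf : Poly f) (hb : Poly b) (hi : Poly i) (hj : Poly j) :
    Poly fun x => wt (f x) (b x) (i x) (j x) :=
  getD (getD (mat hf hb) hi []) hj 0

theorem wt₁ (hf : Poly f) (hb : Poly b) (hi : Poly i) (hj : Poly j) :
    Poly fun x => wt₁ (f x) (b x) (i x) (j x) :=
  ite_eq hb (const 0) (wt hf hb hi hj) (sub (wmax hf hb) (wt hf hb hi hj))

theorem wt₂ (hf : Poly f) (hb : Poly b) (hi : Poly i) (hj : Poly j) :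
    Poly fun x => wt₂ (f x) (b x) (i x) (j x) :=
  ite_eq hb (const 0) (sub (wmax hf hb) (wt hf hb hi hj)) (wt hf hb hi hj)

theorem gap (hf : Poly f) (hs : Poly s) (ht : Poly t) (hb : Poly b) (hi : Poly i) (hj : Poly j) :
    Poly fun x => gap (f x) (s x) (t x) (b x) (i x) (j x) :=
  have h0 := const_mul 2 (slack hf hb)
  have h1 := ite_eq hi hj (sub (sub (lo hf ht hb) (lo hf hs hb)) (slack hf hb)) (const 0)
  ite_eq hs ht (ite_eq hi hj (const 0) (const_mul 6 (slack hf hb))) <|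
  ite_eq hs (const 2) (ite_eq ht (const 3) (add h0 (wt₁ hf hb hi hj))
    (ite_eq ht (const 5) h1 (const 0))) <|
  ite_eq hs (const 3) (ite_eq ht (const 4) h0 (ite_eq ht (const 6) h1 (const 0))) <|
  ite_eq hs (const 4) (ite_eq ht (const 2) h0 (const 0)) <|
  ite_eq hs (const 5) (ite_eq ht (const 6) (add h0 (wt₂ hf hb hi hj)) (const 0)) <|
  ite_eq hs (const 6) (ite_eq ht (const 7) h0 (const 0)) <|
  ite_eq hs (const 7) (ite_eq ht (const 5) h0 (const 0)) (const 0)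

theorem link (hf : Poly f) (hs : Poly s) (ht : Poly t) (hb : Poly b) :
    Poly fun x => link (f x) (s x) (t x) (b x) :=
  ite_eq hs (const 4) (ite_eq ht (const 2) (ite_eq hb (const 0)
    (const_mul 2 (slack hf (const 0))) (const 0)) (const 0)) <|
  ite_eq hs (const 7) (ite_eq ht (const 5) (ite_eq hb (const 0) (const 0)
    (const_mul 2 (slack hf (const 1)))) (const 0)) (const 0)

theorem edge {u v : α → Vtx} (hf : Poly f) (hu : Poly u) (hv : Poly v) :
    Poly fun x => edge (f x) (u x) (v x) :=
  have hu1 := fst.comp hu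
  have hv1 := fst.comp hv
  have hu2 := fst.comp (snd.comp hu)
  have hv2 := fst.comp (snd.comp hv)
  ite_eq hu1 (const 0) (lo hf hv1 hv2) <|
  ite_eq hv1 (const 1) (sub (total hf) (hi hf hu1 hu2)) <|
  ite_eq hu2 hv2 (gap hf hu1 hv1 hu2 (snd.comp (snd.comp hu)) (snd.comp (snd.comp hv)))
    (link hf hu1 hv1 hu2)

theorem verts (hf : Poly f) : Poly fun x => verts (f x) :=
  flatMap (f := fun x s => ((List.range (f x).1.length).map fun i => ((s, 0, i) : Vtx)) ++
      (List.range (f x).2.length).map fun i => (s, 1, i))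
    (append
      (map (f := fun (p : α × ℕ) (i : ℕ) => ((p.2, 0, i) : Vtx))
        (pair (snd.comp fst) (pair (const 0) snd))
        (range_length (fst.comp (hf.comp fst))))
      (map (f := fun (p : α × ℕ) (i : ℕ) => ((p.2, 1, i) : Vtx))
        (pair (snd.comp fst) (pair (const 1) snd))
        (range_length (snd.comp (hf.comp fst)))))
    (const (List.range 8))

end

theorem reduce : Poly reduce :=
  pair
    (map (f := fun I u => (MatchingReduction.verts I).map fun v => dist I u v)
      (map (f := fun (p : Mats × Vtx) v => dist p.1 p.2 v)
        (max (edge (fst.comp fst) (snd.comp fst) snd) (edge (fst.comp fst) snd (snd.comp fst)))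
        (verts fst))
      (verts id))
    (add (total id) (const 1))

end StackProg.Poly

namespace MatchingReduction

open StackProg StackProg.Obj Computability Turing Prog

/-- The weight matrices of an instance. -/
def mats (J : CommonMatchingWeight) : Mats :=
  (List.ofFn fun i => List.ofFn fun j => J.G₁.w i j, List.ofFn fun i => List.ofFn fun j => J.G₂.w i j)

/-- The reduction. -/
def toChannelAssignment (J : CommonMatchingWeight) : ChannelAssignment where
  n := (verts (mats J)).length
  d x y := dist (mats J) (verts (mats J))[x] (verts (mats J))[y]
  d_symm x y := max_comm _ _
  d_self x := by
    simp only [dist, edge, max_self]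
    generalize (verts (mats J))[x] = v
    split_ifs with h1 h2
    · simp [lo, h1]
    · simp [hi, h2]
    · simp [gap]
  s := total (mats J) + 1

theorem encode_eq (J : CommonMatchingWeight) : J.encode = enc (mats J).1 ++ enc (mats J).2 := rfl

theorem encode_toChannelAssignment (J : CommonMatchingWeight) :
    (toChannelAssignment J).encode = enc (reduce (mats J)).1 ++ enc (reduce (mats J)).2 := by
  have h : ∀ {β : Type} (l : List Vtx) (f : Vtx → β),
      List.ofFn (fun i : Fin l.length => f l[i]) = l.map f := fun l f => by
    apply List.ext_getElem <;> simp
  refine congrArg₂ (· ++ ·) ?_ rfl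
  refine congrArg (enc (α := List (List ℕ))) ?_
  exact (List.ofFn_inj.2 (funext fun i => h _ _)).trans
    (h (verts (mats J)) fun u => (verts (mats J)).map fun v => dist (mats J) u v)

theorem polyTime : Nonempty (TM2ComputableInPolyTime
    CommonMatchingWeight.encode ChannelAssignment.encode toChannelAssignment) := by
  obtain ⟨q, hq⟩ := Poly.reduce.polySize
  obtain ⟨P, p, h⟩ := Poly.reduce
  refine ⟨polyTimeOfProg ((mv .m [.a]).seq <| (mv .m [.b]).seq <| (push .m Γ'.ket).seq <|
    (mv .b [.m]).seq <| (mv .a [.m]).seq <| (push .m Γ'.bra).seq <| P.seq <|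
    (pop .m fun _ => skip).seq <| (mv .m [.a]).seq <| (mv .m [.b]).seq <|
    (pop .m fun _ => skip).seq <| (mv .b [.m]).seq <| mv .a [.m])
    (20 * .X + p.comp (.X + 2) + 20 * q.comp (.X + 2) + 200) fun J => ?_⟩
  have h1 := h (mats J) [] [] [] [] []
  have h2 := hq (mats J)
  rw [enc_pair] at h1
  generalize hr : reduce (mats J) = r at *
  obtain ⟨r1, r2⟩ := r
  rw [enc_pair] at h1
  simp only [List.append_nil, List.append_assoc] at h1
  have h3 := (runs_mv_m_a (isObj (mats J).1)).seq <| (runs_mv_m_b (isObj (mats J).2)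
    (m := [])).seq <| (runs_push_m (x := Γ'.ket)).seq <| (runs_mv_b_m (isObj (mats J).2)).seq <|
    (runs_mv_a_m (isObj (mats J).1)).seq <| runs_push_m.seq <| h1.seq <| runs_pop_m.seq <|
    (runs_mv_m_a (isObj r1)).seq <| (runs_mv_m_b (isObj r2)).seq <| runs_pop_m.seq <|
    (runs_mv_b_m (isObj r2)).seq (runs_mv_a_m (isObj r1))
  rw [encode_eq, encode_toChannelAssignment, hr]
  simp only [List.append_nil] at h3
  refine h3.mono ?_
  have e1 : size (mats J) = (enc (mats J).1 ++ enc (mats J).2).length + 2 := by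
    rw [List.length_append]
    exact size_pair _ _
  have e2 : size (r1, r2) = (enc r1).length + (enc r2).length + 2 := by
    exact size_pair _ _
  rw [e1] at h2
  rw [e2] at h2
  simp only [e1, Polynomial.eval_add, Polynomial.eval_mul, Polynomial.eval_comp, Polynomial.eval_X,
    Polynomial.eval_ofNat, List.length_append] at *
  omega

end MatchingReduction

/-! ## Perfect matchings and permutations -/

namespace WeightedBipartite

open Equiv

theorem exists_perm (G : WeightedBipartite) (M : G.graph.Subgraph) (hM : M.IsPerfectMatching) :
    ∃ π : Perm (Fin G.k), G.weight M = ∑ i, G.w i (π i) := by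
  classical
  rw [SimpleGraph.Subgraph.isPerfectMatching_iff] at hM
  have h1 : ∀ i, ∃ j, M.Adj (Sum.inl i) (Sum.inr j) := fun i => by
    obtain ⟨x, hx, -⟩ := hM (Sum.inl i)
    cases x with
    | inl j => simpa using M.adj_sub hx
    | inr j => exact ⟨j, hx⟩
  choose f hf using h1
  have hinj : Function.Injective f := fun i j h => by
    have h1 := (hf i).symm
    have h2 := (hf j).symm
    rw [← h] at h2
    exact Sum.inl_injective ((hM (Sum.inr (f i))).unique h1 h2)
  refine ⟨Equiv.ofBijective f (Finite.injective_iff_bijective.1 hinj), ?_⟩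
  have h2 : ∀ i j, M.Adj (Sum.inl i) (Sum.inr j) ↔ f i = j := fun i j =>
    ⟨fun h => Sum.inr_injective ((hM (Sum.inl i)).unique (hf i) h), fun h => h ▸ hf i⟩
  simp [weight, Finset.sum_filter, Fintype.sum_prod_type, h2]

theorem exists_isPerfectMatching (G : WeightedBipartite) (π : Perm (Fin G.k)) :
    ∃ M : G.graph.Subgraph, M.IsPerfectMatching ∧ G.weight M = ∑ i, G.w i (π i) := by
  classical
  let adj : Fin G.k ⊕ Fin G.k → Fin G.k ⊕ Fin G.k → Prop
    | .inl i, .inr j => π i = j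
    | .inr j, .inl i => π i = j
    | _, _ => False
  let M : G.graph.Subgraph :=
    { verts := Set.univ
      Adj := adj
      adj_sub := by rintro (i | i) (j | j) h <;> simp [adj] at h ⊢
      edge_vert := fun _ => Set.mem_univ _
      symm := ⟨by rintro (i | i) (j | j) h <;> exact h⟩ }
  refine ⟨M, ?_, ?_⟩
  · rw [SimpleGraph.Subgraph.isPerfectMatching_iff]
    rintro (i | j)
    · refine ⟨.inr (π i), rfl, ?_⟩
      rintro (x | x) hx
      · exact hx.elim
      · exact congrArg _ (Eq.symm hx)
    · refine ⟨.inl (π.symm j), π.apply_symm_apply j, ?_⟩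
      rintro (x | x) hx
      · exact congrArg _ (π.eq_symm_apply.2 hx)
      · exact hx.elim
  · have h2 : ∀ i j, M.Adj (Sum.inl i) (Sum.inr j) ↔ π i = j := fun i j => Iff.rfl
    simp [weight, Finset.sum_filter, Fintype.sum_prod_type, h2]

end WeightedBipartite

theorem CommonMatchingWeight.isYes_iff (I : CommonMatchingWeight) :
    I.IsYes ↔ ∃ (π₁ : Equiv.Perm (Fin I.G₁.k)) (π₂ : Equiv.Perm (Fin I.G₂.k)),
      ∑ i, I.G₁.w i (π₁ i) = ∑ i, I.G₂.w i (π₂ i) := by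
  constructor
  · rintro ⟨M₁, M₂, h₁, h₂, h⟩
    obtain ⟨π₁, e₁⟩ := I.G₁.exists_perm M₁ h₁
    obtain ⟨π₂, e₂⟩ := I.G₂.exists_perm M₂ h₂
    exact ⟨π₁, π₂, by rw [← e₁, h, e₂]⟩
  · rintro ⟨π₁, π₂, h⟩
    obtain ⟨M₁, h₁, e₁⟩ := I.G₁.exists_isPerfectMatching π₁
    obtain ⟨M₂, h₂, e₂⟩ := I.G₂.exists_isPerfectMatching π₂
    exact ⟨M₁, M₂, h₁, h₂, by rw [e₁, h, e₂]⟩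

theorem ChannelAssignment.span_le_iff {n : ℕ} (c : Fin n → ℤ) (s : ℕ) :
    ChannelAssignment.span c ≤ (s + 1 : ℕ) ↔ ∀ x y, c x - c y ≤ s := by
  unfold ChannelAssignment.span
  split_ifs with h
  · constructor
    · intro h1 x y
      have h2 := Finset.le_sup' c (Finset.mem_univ x)
      have h3 := Finset.inf'_le c (Finset.mem_univ y)
      push_cast at h1
      linarith
    · intro h1
      obtain ⟨x, -, hx⟩ := Finset.exists_mem_eq_sup' h c
      obtain ⟨y, -, hy⟩ := Finset.exists_mem_eq_inf' h c
      rw [hx, hy]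
      push_cast
      linarith [h1 x y]
  · refine ⟨fun _ x => ?_, fun _ => by positivity⟩
    exact absurd ⟨x, Finset.mem_univ x⟩ h

namespace MatchingReduction

/-- Positions of the vertices on a line of the given length, at the required distances. -/
structure Fits (I : Mats) (p : Vtx → ℤ) : Prop where
  edge_le : ∀ u ∈ verts I, ∀ v ∈ verts I, (edge I u v : ℤ) ≤ |p u - p v|
  sub_le : ∀ u ∈ verts I, ∀ v ∈ verts I, p u - p v ≤ total I

theorem isYes_toChannelAssignment_iff (J : CommonMatchingWeight) :
    (toChannelAssignment J).IsYes ↔ ∃ p, Fits (mats J) p := by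
  set I := mats J with hI
  constructor
  · rintro ⟨c, hc, hs⟩
    replace hs := (ChannelAssignment.span_le_iff c (total I)).1 hs
    replace hc : ∀ x y : Fin (verts I).length, (dist I (verts I)[x] (verts I)[y] : ℤ) ≤
      |c x - c y| := hc
    classical
    have h : ∀ u ∈ verts I, ∃ x : Fin (verts I).length, (verts I)[x] = u := fun u hu => by
      obtain ⟨i, hi, h⟩ := List.getElem_of_mem hu
      exact ⟨⟨i, hi⟩, h⟩
    refine ⟨fun u => if hu : u ∈ verts I then c (h u hu).choose else 0, ?_, ?_⟩
    · intro u hu v hv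
      simp only [hu, hv, dite_true]
      refine le_trans ?_ (hc _ _)
      rw [(h u hu).choose_spec, (h v hv).choose_spec]
      exact_mod_cast le_max_left _ _
    · intro u hu v hv
      simp only [hu, hv, dite_true]
      exact hs _ _
  · rintro ⟨p, hp⟩
    refine ⟨fun x => p (verts I)[x], fun x y => ?_, ?_⟩
    · have hx : (verts I)[x] ∈ verts I := List.getElem_mem _
      have hy : (verts I)[y] ∈ verts I := List.getElem_mem _
      change ((max _ _ : ℕ) : ℤ) ≤ _
      rw [Nat.cast_max]
      exact max_le (hp.edge_le _ hx _ hy) (abs_sub_comm (p _) (p _) ▸ hp.edge_le _ hy _ hx)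
    · exact (ChannelAssignment.span_le_iff _ (total I)).2 fun x y =>
        hp.sub_le _ (List.getElem_mem _) _ (List.getElem_mem _)

end MatchingReduction

/-! ## From assignments to matchings -/

namespace MatchingReduction

open Equiv

/-- Points in a short interval which are far apart are close to the points of a progression. -/
theorem exists_ranks {n : ℕ} {L R B : ℤ} (hR : 0 ≤ R) (hRL : R < L) {v : Fin n → ℤ}
    (h1 : ∀ i, B ≤ v i) (h2 : ∀ i, v i ≤ B + L * (n - 1) + R)
    (h3 : ∀ i j, i ≠ j → L ≤ |v i - v j|) :
    ∃ ρ : Perm (Fin n), ∀ i, B + L * (ρ i : ℕ) ≤ v i ∧ v i ≤ B + L * (ρ i : ℕ) + R := by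
  have hL : 0 < L := by linarith
  let r : Fin n → ℤ := fun i => (v i - B) / L
  have hr1 : ∀ i, L * r i ≤ v i - B := fun i => Int.mul_ediv_self_le hL.ne'
  have hr2 : ∀ i, v i - B < L * r i + L := fun i => Int.lt_mul_ediv_self_add hL
  have hr0 : ∀ i, 0 ≤ r i := fun i => Int.ediv_nonneg (by linarith [h1 i]) hL.le
  have hrn : ∀ i, r i < n := fun i => by
    have := h2 i
    have := hr1 i
    by_contra! h
    nlinarith
  have hinj : ∀ i j, r i = r j → i = j := fun i j h => by
    by_contra hij
    have e1 := h3 i j hij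
    have e2 := hr1 i
    have e3 := hr1 j
    have e4 := hr2 i
    have e5 := hr2 j
    rw [h] at e2 e4
    rcases abs_cases (v i - v j) with h | h <;> linarith
  let f : Fin n → Fin n := fun i => ⟨(r i).toNat, by have := hrn i; have := hr0 i; omega⟩
  have hf : Function.Injective f := fun i j h => hinj i j <| by
    have := congrArg Fin.val h
    have := hr0 i
    have := hr0 j
    simp only [f] at *
    omega
  let ρ : Perm (Fin n) := Equiv.ofBijective f (Finite.injective_iff_bijective.1 hf)
  have hρ : ∀ i, ((ρ i : ℕ) : ℤ) = r i := fun i => by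
    have := hr0 i
    change (((r i).toNat : ℕ) : ℤ) = r i
    omega
  refine ⟨ρ, fun i => ⟨by rw [hρ]; linarith [hr1 i], ?_⟩⟩
  have key : ∀ m : ℕ, ∀ i, (ρ i : ℕ) + m + 1 = n → v i ≤ B + L * (ρ i : ℕ) + R := by
    intro m
    induction m with
    | zero =>
      intro i hi
      have e : ((n : ℤ) - 1) = (ρ i : ℕ) := by omega
      have := h2 i
      rwa [e] at this
    | succ m ih =>
      intro i hi
      obtain ⟨j, hj⟩ := ρ.surjective ⟨(ρ i : ℕ) + 1, by omega⟩
      have hj' : (ρ j : ℕ) = ρ i + 1 := congrArg Fin.val hj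
      have e1 := ih j (by omega)
      have e2 := hr2 i
      have e3 := hr1 j
      have e4 := h3 i j (by rintro rfl; omega)
      rw [← hρ] at e2 e3
      rw [hj'] at e1 e3
      push_cast at e1 e3
      rw [abs_of_nonpos (by linarith)] at e4
      linarith
  exact key (n - 1 - ρ i) i (by omega)

/-- Summation along a chain of points. -/
theorem chain_bound {n : ℕ} {S R B α : ℤ} (hS : 0 < S) (hR : 0 ≤ R) (hRS : R ≤ S)
    {A : Fin n → Fin n → ℕ} {v w u : Fin n → ℤ}
    (hv : ∀ i, B ≤ v i ∧ v i ≤ B + 6 * S * (n - 1) + S)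
    (hw : ∀ i, B + 2 * S ≤ w i ∧ w i ≤ B + 2 * S + 6 * S * (n - 1) + S)
    (hu : ∀ i, B + 4 * S ≤ u i ∧ u i ≤ B + 4 * S + 6 * S * (n - 1) + R)
    (hvv : ∀ i j, i ≠ j → 6 * S ≤ |v i - v j|) (hww : ∀ i j, i ≠ j → 6 * S ≤ |w i - w j|)
    (huu : ∀ i j, i ≠ j → 6 * S ≤ |u i - u j|)
    (hvw : ∀ i j, 2 * S + A i j ≤ |v i - w j|) (hwu : ∀ i j, 2 * S ≤ |w i - u j|)
    (huv : ∀ i j, 2 * S ≤ |u i - v j|) (hα : ∀ i, B + α ≤ v i) (hn : 0 < n) :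
    ∃ ρ σ : Perm (Fin n),
      (∀ i, B + 6 * S * (ρ i : ℕ) ≤ v i ∧ v i ≤ B + 6 * S * (ρ i : ℕ) + S) ∧
      (∀ i, B + 2 * S + 6 * S * (σ i : ℕ) ≤ w i ∧ w i ≤ B + 2 * S + 6 * S * (σ i : ℕ) + S) ∧
      ∃ j, B + 4 * S + 6 * S * (n - 1) + α + ∑ i, (A i (σ.symm (ρ i)) : ℤ) ≤ u j := by
  obtain ⟨ρ, hρ⟩ := exists_ranks hS.le (by linarith) (fun i => (hv i).1) (fun i => (hv i).2) hvv
  obtain ⟨σ, hσ⟩ := exists_ranks hS.le (by linarith) (fun i => (hw i).1) (fun i => (hw i).2) hww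
  obtain ⟨τ, hτ⟩ := exists_ranks hR (by linarith) (fun i => (hu i).1) (fun i => (hu i).2) huu
  refine ⟨ρ, σ, hρ, hσ, ?_⟩
  let a : ℕ → ℤ := fun r => if h : r < n then A (ρ.symm ⟨r, h⟩) (σ.symm ⟨r, h⟩) else 0
  have e1 : ∀ r (h : r < n), v (ρ.symm ⟨r, h⟩) + 2 * S + a r ≤ w (σ.symm ⟨r, h⟩) := fun r h => by
    have h1 := hρ (ρ.symm ⟨r, h⟩)
    have h2 := hσ (σ.symm ⟨r, h⟩)
    have h3 := hvw (ρ.symm ⟨r, h⟩) (σ.symm ⟨r, h⟩)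
    rw [apply_symm_apply] at h1 h2
    simp only [a, h, dite_true]
    rw [abs_of_nonpos (by linarith)] at h3
    linarith
  have e2 : ∀ r (h : r < n), w (σ.symm ⟨r, h⟩) + 2 * S ≤ u (τ.symm ⟨r, h⟩) := fun r h => by
    have h1 := hσ (σ.symm ⟨r, h⟩)
    have h2 := hτ (τ.symm ⟨r, h⟩)
    have h3 := hwu (σ.symm ⟨r, h⟩) (τ.symm ⟨r, h⟩)
    rw [apply_symm_apply] at h1 h2
    rw [abs_of_nonpos (by linarith)] at h3
    linarith
  have e3 : ∀ r (h : r + 1 < n), u (τ.symm ⟨r, by omega⟩) + 2 * S ≤ v (ρ.symm ⟨r + 1, h⟩) :=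
    fun r h => by
      have h1 := hτ (τ.symm ⟨r, by omega⟩)
      have h2 := hρ (ρ.symm ⟨r + 1, h⟩)
      have h3 := huv (τ.symm ⟨r, by omega⟩) (ρ.symm ⟨r + 1, h⟩)
      rw [apply_symm_apply] at h1 h2
      push_cast at h2
      rw [abs_of_nonpos (by linarith)] at h3
      linarith
  have e4 : ∀ r (h : r < n), B + 4 * S + 6 * S * r + α + ∑ q ∈ Finset.range (r + 1), a q ≤
      u (τ.symm ⟨r, h⟩) := by
    intro r
    induction r with
    | zero =>
      intro h
      have := e1 0 h
      have := e2 0 h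
      have := hα (ρ.symm ⟨0, h⟩)
      simp
      linarith
    | succ r ih =>
      intro h
      have := ih (by omega)
      have := e1 (r + 1) h
      have := e2 (r + 1) h
      have := e3 r h
      rw [Finset.sum_range_succ]
      push_cast
      linarith
  refine ⟨τ.symm ⟨n - 1, by omega⟩, le_trans (le_of_eq ?_) (e4 (n - 1) (by omega))⟩
  have e5 : ((n - 1 : ℕ) : ℤ) = (n : ℤ) - 1 := by omega
  have e6 : n - 1 + 1 = n := by omega
  rw [e5, e6, Finset.sum_range]
  congr 1
  rw [← Equiv.sum_comp ρ fun r : Fin n => a r]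
  refine Finset.sum_congr rfl fun i _ => ?_
  simp [a]

theorem perm_eq_of_le {n : ℕ} {ρ ρ' : Perm (Fin n)} (h : ∀ i, (ρ i : ℕ) ≤ ρ' i) : ρ = ρ' := by
  have h1 : ∑ i, (ρ i : ℕ) = ∑ i, (ρ' i : ℕ) :=
    (Equiv.sum_comp ρ fun i : Fin n => (i : ℕ)).trans
      (Equiv.sum_comp ρ' fun i : Fin n => (i : ℕ)).symm
  ext i
  exact (Finset.sum_eq_sum_iff_of_le fun i _ => h i).1 h1 i (Finset.mem_univ i)

/-- Points at a fixed distance have the same ranks. -/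
theorem ranks_eq {n : ℕ} {S B B' : ℤ} (hS : 0 < S) {v v' : Fin n → ℤ} {ρ ρ' : Perm (Fin n)}
    (hv : ∀ i, B + 6 * S * (ρ i : ℕ) ≤ v i ∧ v i ≤ B + 6 * S * (ρ i : ℕ) + S)
    (hv' : ∀ i, B' + 6 * S * (ρ' i : ℕ) ≤ v' i ∧ v' i ≤ B' + 6 * S * (ρ' i : ℕ) + S)
    (hBB' : B + 6 * S * n ≤ B') (h : ∀ i, B' - B - S ≤ |v i - v' i|) : ρ = ρ' := by
  refine perm_eq_of_le fun i => ?_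
  have h1 := hv i
  have h2 := hv' i
  have h3 := h i
  have h4 : ((ρ i : ℕ) : ℤ) + 1 ≤ n := by have := (ρ i).2; omega
  by_contra! h5
  have h6 : ((ρ' i : ℕ) : ℤ) + 1 ≤ (ρ i : ℕ) := by omega
  have h7 : (0 : ℤ) ≤ (ρ' i : ℕ) := by positivity
  rw [abs_of_nonpos (by nlinarith)] at h3
  nlinarith

theorem mem_verts {I : Mats} {s b i : ℕ} :
    (s, b, i) ∈ verts I ↔ s < 8 ∧ b < 2 ∧ i < cnt I b := by
  simp only [verts, List.mem_flatMap, List.mem_range, List.mem_append, List.mem_map, Prod.mk.injEq]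
  constructor
  · rintro ⟨s, hs, ⟨i, hi, rfl, rfl, rfl⟩ | ⟨i, hi, rfl, rfl, rfl⟩⟩
    · exact ⟨hs, by omega, by simpa [cnt, mat] using hi⟩
    · exact ⟨hs, by omega, by simpa [cnt, mat] using hi⟩
  · rintro ⟨hs, hb, hi⟩
    interval_cases b
    · exact ⟨s, hs, .inl ⟨i, by simpa [cnt, mat] using hi, rfl, rfl, rfl⟩⟩
    · exact ⟨s, hs, .inr ⟨i, by simpa [cnt, mat] using hi, rfl, rfl, rfl⟩⟩

/-- Positions as in `Fits`, with the ends at their places; only the constraints on the other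
vertices are listed. -/
structure Normal (I : Mats) (p : Vtx → ℤ) : Prop where
  lo_le : ∀ {s b i}, 2 ≤ s → s < 8 → b < 2 → i < cnt I b → (lo I s b : ℤ) ≤ p (s, b, i)
  le_hi : ∀ {s b i}, 2 ≤ s → s < 8 → b < 2 → i < cnt I b → p (s, b, i) ≤ hi I s b
  gap_le : ∀ {s t b i j}, 2 ≤ s → s < 8 → 2 ≤ t → t < 8 → b < 2 → i < cnt I b → j < cnt I b →
    (gap I s t b i j : ℤ) ≤ |p (s, b, i) - p (t, b, j)|
  link_le : ∀ {s t b b' i j}, 2 ≤ s → s < 8 → 2 ≤ t → t < 8 → b < 2 → b' < 2 → b ≠ b' →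
    i < cnt I b → j < cnt I b' → (link I s t b : ℤ) ≤ |p (s, b, i) - p (t, b', j)|

theorem Fits.exists_normal {I : Mats} {p : Vtx → ℤ} (h : Fits I p) : ∃ p, Normal I p := by
  by_cases h0 : ∃ b i, b < 2 ∧ i < cnt I b
  swap
  · push Not at h0
    exact ⟨p, ⟨fun {s b i} _ _ h1 h2 => absurd h2 (by simpa using h0 b i h1),
      fun {s b i} _ _ h1 h2 => absurd h2 (by simpa using h0 b i h1),
      fun {s t b i j} _ _ _ _ h1 h2 => absurd h2 (by simpa using h0 b i h1),
      fun {s t b b' i j} _ _ _ _ h1 _ _ h2 => absurd h2 (by simpa using h0 b i h1)⟩⟩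
  obtain ⟨b₀, i₀, hb₀, hi₀⟩ := h0
  have hx : (0, b₀, i₀) ∈ verts I := mem_verts.2 ⟨by omega, hb₀, hi₀⟩
  have hy : (1, b₀, i₀) ∈ verts I := mem_verts.2 ⟨by omega, hb₀, hi₀⟩
  obtain ⟨q, hq, hqx, hqy⟩ : ∃ q, Fits I q ∧ q (0, b₀, i₀) = 0 ∧ q (1, b₀, i₀) = total I := by
    have h1 := h.edge_le _ hx _ hy
    have h2 := h.sub_le _ hx _ hy
    have h3 := h.sub_le _ hy _ hx
    have e : edge I (0, b₀, i₀) (1, b₀, i₀) = total I := by simp [edge, lo]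
    rw [e] at h1
    rcases abs_cases (p (0, b₀, i₀) - p (1, b₀, i₀)) with h4 | h4
    · refine ⟨fun u => p (0, b₀, i₀) - p u, ⟨fun u hu v hv => ?_, fun u hu v hv => ?_⟩,
        by simp, by linarith⟩
      · have := h.edge_le u hu v hv
        rw [abs_sub_comm] at this
        convert this using 2
        ring
      · linarith [h.sub_le v hv u hu]
    · refine ⟨fun u => p u - p (0, b₀, i₀), ⟨fun u hu v hv => ?_, fun u hu v hv => ?_⟩,
        by simp, by linarith⟩
      · convert h.edge_le u hu v hv using 2
        ring
      · linarith [h.sub_le u hu v hv]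
  refine ⟨q, ?_, ?_, ?_, ?_⟩
  · intro s b i h2 h8 hb hi
    have hv : (s, b, i) ∈ verts I := mem_verts.2 ⟨h8, hb, hi⟩
    have h1 := hq.edge_le _ hx _ hv
    have h3 := hq.sub_le _ hy _ hv
    rw [show edge I (0, b₀, i₀) (s, b, i) = lo I s b by simp [edge]] at h1
    rw [hqx, zero_sub, abs_neg, abs_of_nonneg (by linarith)] at h1
    exact h1
  · intro s b i h2 h8 hb hib
    have hv : (s, b, i) ∈ verts I := mem_verts.2 ⟨h8, hb, hib⟩
    have h1 := hq.edge_le _ hv _ hy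
    have h3 := hq.sub_le _ hv _ hx
    rw [show edge I (s, b, i) (1, b₀, i₀) = total I - hi I s b by
      simp [edge, show s ≠ 0 by omega]] at h1
    rw [hqy, abs_sub_comm, abs_of_nonneg (by linarith)] at h1
    omega
  · intro s t b i j h2 h8 h2' h8' hb hi hj
    have h1 := hq.edge_le _ (mem_verts.2 ⟨h8, hb, hi⟩) _ (mem_verts.2 ⟨h8', hb, hj⟩)
    simpa [edge, show s ≠ 0 by omega, show t ≠ 1 by omega] using h1
  · intro s t b b' i j h2 h8 h2' h8' hb hb' hbb' hi hj
    have h1 := hq.edge_le _ (mem_verts.2 ⟨h8, hb, hi⟩) _ (mem_verts.2 ⟨h8', hb', hj⟩)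
    simpa [edge, show s ≠ 0 by omega, show t ≠ 1 by omega, hbb'] using h1

end MatchingReduction

namespace MatchingReduction

open Equiv

theorem le_foldl_max {l : List ℕ} {x k : ℕ} (h : x ≤ k ∨ x ∈ l) : x ≤ l.foldl Max.max k := by
  induction l generalizing k with
  | nil => simpa using h
  | cons y l ih =>
    refine ih ?_
    rcases h with h | h
    · exact .inl (h.trans (le_max_left _ _))
    · rcases List.mem_cons.1 h with rfl | h
      · exact .inl (le_max_right _ _)
      · exact .inr h

theorem wt_le_wmax (I : Mats) (b i j : ℕ) : wt I b i j ≤ wmax I b := by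
  have h0 : ∀ (l : List ℕ) j, l.getD j 0 ≤ l.foldl Max.max 0 := fun l j => by
    by_cases hj : j < l.length
    · rw [List.getD_eq_getElem _ _ hj]
      exact le_foldl_max (.inr (List.getElem_mem _))
    · rw [List.getD_eq_default _ _ (by omega)]
      exact Nat.zero_le _
  refine (h0 _ j).trans ?_
  by_cases hi : i < (mat I b).length
  · rw [List.getD_eq_getElem _ _ hi]
    exact le_foldl_max (.inr (List.mem_map.2 ⟨_, List.getElem_mem _, rfl⟩))
  · rw [List.getD_eq_default _ _ (by omega)]
    exact Nat.zero_le _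

theorem slack_eq (I : Mats) (b : ℕ) : slack I b = cnt I b * wmax I b := rfl

theorem scale_eq (I : Mats) (b : ℕ) : scale I b = cnt I b * slack I b := rfl

theorem room_le (I : Mats) (s : ℕ) {b : ℕ} (hb : b < 2) : room I s b ≤ slack I b := by
  interval_cases b <;> simp only [room] <;> split_ifs <;> simp

/-- The chain bound in one of the halves. -/
theorem Normal.chain {I : Mats} {p : Vtx → ℤ} (hp : Normal I p) {s b : ℕ} {A : ℕ → ℕ → ℕ}
    (hs : s = 2 ∧ A = wt₁ I b ∨ s = 5 ∧ A = wt₂ I b) (hb : b < 2) (hS : 0 < slack I b) {α : ℤ}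
    (hα : ∀ i < cnt I b, base I s b + α ≤ p (s, b, i)) :
    ∃ ρ σ : Perm (Fin (cnt I b)),
      (∀ i, lo I s b + 6 * (slack I b : ℤ) * (ρ i : ℕ) ≤ p (s, b, i) ∧
        p (s, b, i) ≤ lo I s b + 6 * (slack I b : ℤ) * (ρ i : ℕ) + slack I b) ∧
      (∀ i, lo I (s + 1) b + 6 * (slack I b : ℤ) * (σ i : ℕ) ≤ p (s + 1, b, i) ∧
        p (s + 1, b, i) ≤ lo I (s + 1) b + 6 * (slack I b : ℤ) * (σ i : ℕ) + slack I b) ∧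
      ∃ j < cnt I b, base I s b + 6 * (scale I b : ℤ) - 2 * slack I b + α +
        ∑ i : Fin (cnt I b), (A i (σ.symm (ρ i)) : ℤ) ≤ p (s + 2, b, j) := by
  have hn : 0 < cnt I b := by
    by_contra! h
    rw [slack_eq, Nat.le_zero.1 h, zero_mul] at hS
    exact lt_irrefl _ hS
  have hQ : ((6 * scale I b - 6 * slack I b : ℕ) : ℤ) =
      6 * (slack I b : ℤ) * ((cnt I b : ℤ) - 1) := by
    have : slack I b ≤ scale I b := Nat.le_mul_of_pos_left _ hn
    rw [Nat.cast_sub (by omega), scale_eq]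
    push_cast
    ring
  have hQ' : (scale I b : ℤ) = cnt I b * slack I b := by rw [scale_eq]; push_cast; ring
  have hlo : lo I s b = base I s b := by
    rcases hs with ⟨rfl, -⟩ | ⟨rfl, -⟩ <;> simp [lo, shift]
  have hlo1 : lo I (s + 1) b = base I s b + 2 * slack I b := by
    rcases hs with ⟨rfl, -⟩ | ⟨rfl, -⟩ <;> simp [lo, shift, base]
  have hlo2 : lo I (s + 2) b = base I s b + 4 * slack I b := by
    rcases hs with ⟨rfl, -⟩ | ⟨rfl, -⟩ <;> simp [lo, shift, base]
  have hhi : hi I s b = base I s b + (6 * scale I b - 6 * slack I b) + slack I b := by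
    rcases hs with ⟨rfl, -⟩ | ⟨rfl, -⟩ <;> simp [hi, room, hlo]
  have hhi1 : hi I (s + 1) b =
      base I s b + 2 * slack I b + (6 * scale I b - 6 * slack I b) + slack I b := by
    rcases hs with ⟨rfl, -⟩ | ⟨rfl, -⟩ <;> simp [hi, room, ← hlo1]
  have hhi2 : hi I (s + 2) b = base I s b + 4 * slack I b + (6 * scale I b - 6 * slack I b) +
      room I (s + 2) b := by
    rcases hs with ⟨rfl, -⟩ | ⟨rfl, -⟩ <;> simp [hi, ← hlo2]
  have h2 : 2 ≤ s ∧ s + 2 < 8 := by omega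
  have hgap : ∀ t, 2 ≤ t → t < 8 → ∀ i j : Fin (cnt I b), i ≠ j →
      6 * (slack I b : ℤ) ≤ |p (t, b, i) - p (t, b, j)| := fun t ht ht' i j hij => by
    have := hp.gap_le ht ht' ht ht' hb i.2 j.2
    rw [show gap I t t b i j = 6 * slack I b by simp [gap, Fin.val_inj, hij]] at this
    exact_mod_cast this
  have hR := room_le I (s + 2) hb
  have hlow : ∀ t, 2 ≤ t → t < 8 → ∀ i : Fin (cnt I b), (lo I t b : ℤ) ≤ p (t, b, i) ∧
      p (t, b, i) ≤ hi I t b := fun t ht ht' i => ⟨hp.lo_le ht ht' hb i.2, hp.le_hi ht ht' hb i.2⟩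
  obtain ⟨ρ, σ, h3, h4, j, h5⟩ := chain_bound (n := cnt I b) (S := slack I b)
    (R := room I (s + 2) b) (B := base I s b) (α := α) (A := fun i j => A i j)
    (v := fun i => p (s, b, i)) (w := fun i => p (s + 1, b, i)) (u := fun i => p (s + 2, b, i))
    (by exact_mod_cast hS) (by positivity) (by exact_mod_cast hR)
    (fun i => by
      have := hlow s (by omega) (by omega) i
      rw [hlo, hhi] at this
      push_cast [hQ] at this
      exact this)
    (fun i => by
      have := hlow (s + 1) (by omega) (by omega) i
      rw [hlo1, hhi1] at this
      push_cast [hQ] at this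
      exact this)
    (fun i => by
      have := hlow (s + 2) (by omega) (by omega) i
      rw [hlo2, hhi2] at this
      push_cast [hQ] at this
      exact this)
    (hgap s (by omega) (by omega)) (hgap (s + 1) (by omega) (by omega))
    (hgap (s + 2) (by omega) (by omega))
    (fun i j => by
      have := hp.gap_le (s := s) (t := s + 1) (by omega) (by omega) (by omega) (by omega) hb i.2 j.2
      refine le_trans (le_of_eq ?_) this
      rcases hs with ⟨rfl, rfl⟩ | ⟨rfl, rfl⟩ <;> simp [gap])
    (fun i j => by
      have := hp.gap_le (s := s + 1) (t := s + 2) (by omega) (by omega) (by omega) (by omega) hb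
        i.2 j.2
      refine le_trans (le_of_eq ?_) this
      rcases hs with ⟨rfl, rfl⟩ | ⟨rfl, rfl⟩ <;> simp [gap])
    (fun i j => by
      have := hp.gap_le (s := s + 2) (t := s) (by omega) (by omega) (by omega) (by omega) hb
        i.2 j.2
      refine le_trans (le_of_eq ?_) this
      rcases hs with ⟨rfl, rfl⟩ | ⟨rfl, rfl⟩ <;> simp [gap])
    (fun i => hα i i.2) hn
  refine ⟨ρ, σ, ?_, ?_, j, j.2, ?_⟩
  · rw [hlo]; exact h3
  · rw [hlo1]; push_cast; exact h4
  · rw [hQ']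
    linarith

theorem sum_wt_of_slack_eq_zero {I : Mats} {b : ℕ} (h : slack I b = 0) (π : Perm (Fin (cnt I b))) :
    ∑ i : Fin (cnt I b), wt I b i (π i) = 0 := by
  refine Finset.sum_eq_zero fun i _ => ?_
  have h1 := wt_le_wmax I b i (π i)
  have h2 := i.2
  rw [slack_eq, Nat.mul_eq_zero] at h
  omega

theorem sum_complement (I : Mats) (b : ℕ) (π : Perm (Fin (cnt I b))) :
    ∑ i : Fin (cnt I b), ((wmax I b - wt I b i (π i) : ℕ) : ℤ) =
      slack I b - ∑ i : Fin (cnt I b), (wt I b i (π i) : ℤ) := by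
  have : ∀ i : Fin (cnt I b), ((wmax I b - wt I b i (π i) : ℕ) : ℤ) =
      wmax I b - wt I b i (π i) := fun i => Nat.cast_sub (wt_le_wmax I b i (π i))
  simp [this, Finset.sum_sub_distrib, slack_eq]

theorem six_mul_cast_sub {I : Mats} {b : ℕ} (hS : 0 < slack I b) :
    ((6 * scale I b - 6 * slack I b : ℕ) : ℤ) = 6 * (scale I b : ℤ) - 6 * slack I b := by
  have hn : 0 < cnt I b := by
    by_contra! h
    rw [slack_eq, Nat.le_zero.1 h, zero_mul] at hS
    exact lt_irrefl _ hS
  have : slack I b ≤ scale I b := Nat.le_mul_of_pos_left _ hn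
  rw [Nat.cast_sub (by omega)]
  push_cast
  ring

/-- Corresponding vertices in the two halves have the same ranks. -/
theorem Normal.ranks_eq {I : Mats} {p : Vtx → ℤ} (hp : Normal I p) {s b : ℕ} (hs : s = 2 ∨ s = 3)
    (hb : b < 2) (hS : 0 < slack I b) {ρ ρ' : Perm (Fin (cnt I b))}
    (h : ∀ i, lo I s b + 6 * (slack I b : ℤ) * (ρ i : ℕ) ≤ p (s, b, i) ∧
      p (s, b, i) ≤ lo I s b + 6 * (slack I b : ℤ) * (ρ i : ℕ) + slack I b)
    (h' : ∀ i, lo I (s + 3) b + 6 * (slack I b : ℤ) * (ρ' i : ℕ) ≤ p (s + 3, b, i) ∧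
      p (s + 3, b, i) ≤ lo I (s + 3) b + 6 * (slack I b : ℤ) * (ρ' i : ℕ) + slack I b) :
    ρ = ρ' := by
  refine MatchingReduction.ranks_eq (by exact_mod_cast hS) h h' ?_ fun i => ?_
  · have h1 : lo I s b + 6 * scale I b ≤ lo I (s + 3) b := by
      rcases hs with rfl | rfl <;> interval_cases b <;> simp [lo, base, shift] <;> omega
    rw [scale_eq] at h1
    zify at h1
    linarith
  · have h1 := hp.gap_le (s := s) (t := s + 3) (by omega) (by omega) (by omega) (by omega) hb i.2 i.2
    rw [show gap I s (s + 3) b i i = lo I (s + 3) b - lo I s b - slack I b by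
      rcases hs with rfl | rfl <;> simp [gap]] at h1
    omega

section values

variable (I : Mats)

theorem lo_two_zero : lo I 2 0 = 0 := by simp [lo, base, shift]
theorem lo_two_one : lo I 2 1 = 6 * scale I 0 := by simp [lo, base, shift]
theorem lo_five_zero : lo I 5 0 = 6 * scale I 0 + 12 * scale I 1 := by simp [lo, base, shift]
theorem lo_five_one : lo I 5 1 = 6 * scale I 0 + 6 * scale I 1 := by simp [lo, base, shift]

variable {I}

theorem hi_four_zero (h : 0 < slack I 0) : (hi I 4 0 : ℤ) =
    6 * scale I 0 - 2 * slack I 0 + (min (slack I 0) (slack I 1) : ℕ) := by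
  have e : hi I 4 0 = 4 * slack I 0 + (6 * scale I 0 - 6 * slack I 0) +
      min (slack I 0) (slack I 1) := by simp [hi, lo, base, shift, room]
  rw [e, Nat.cast_add, Nat.cast_add, six_mul_cast_sub h]
  push_cast
  ring

theorem hi_four_one (h : 0 < slack I 1) : (hi I 4 1 : ℤ) =
    6 * scale I 0 + 6 * scale I 1 - slack I 1 := by
  have e : hi I 4 1 = 6 * scale I 0 + 4 * slack I 1 + (6 * scale I 1 - 6 * slack I 1) +
      slack I 1 := by simp [hi, lo, base, shift, room]
  rw [e, Nat.cast_add, Nat.cast_add, six_mul_cast_sub h]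
  push_cast
  ring

theorem hi_seven_one (h : 0 < slack I 1) : (hi I 7 1 : ℤ) =
    6 * scale I 0 + 12 * scale I 1 - 2 * slack I 1 + (min (slack I 0) (slack I 1) : ℕ) := by
  have e : hi I 7 1 = 6 * scale I 0 + 6 * scale I 1 + 4 * slack I 1 + (6 * scale I 1 - 6 * slack I 1) +
      min (slack I 0) (slack I 1) := by simp [hi, lo, base, shift, room]
  rw [e, Nat.cast_add, Nat.cast_add, six_mul_cast_sub h]
  push_cast
  ring

theorem hi_seven_zero (h : 0 < slack I 0) : (hi I 7 0 : ℤ) =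
    12 * scale I 0 + 12 * scale I 1 - slack I 0 := by
  have e : hi I 7 0 = 6 * scale I 0 + 12 * scale I 1 + 4 * slack I 0 + (6 * scale I 0 - 6 * slack I 0) +
      slack I 0 := by simp [hi, lo, base, shift, room]
  rw [e, Nat.cast_add, Nat.cast_add, six_mul_cast_sub h]
  push_cast
  ring

end values

theorem Normal.exists_perm {I : Mats} {p : Vtx → ℤ} (hp : Normal I p) :
    ∃ (π₀ : Perm (Fin (cnt I 0))) (π₁ : Perm (Fin (cnt I 1))),
      ∑ i : Fin (cnt I 0), wt I 0 i (π₀ i) = ∑ i : Fin (cnt I 1), wt I 1 i (π₁ i) := by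
  have b20 : base I 2 0 = 0 := by simp [base]
  have b21 : base I 2 1 = 6 * scale I 0 := by simp [base]
  have b50 : base I 5 0 = 6 * scale I 0 + 12 * scale I 1 := by simp [base]
  have b51 : base I 5 1 = 6 * scale I 0 + 6 * scale I 1 := by simp [base]
  have first (hS : 0 < slack I 0) := hp.chain (b := 0) (.inl ⟨rfl, rfl⟩) (by omega) hS (α := 0)
    fun i hi => by
      have := hp.lo_le (s := 2) le_rfl (by omega) (by omega) hi
      rw [lo_two_zero] at this
      rwa [b20, add_zero]
  have second (hS : 0 < slack I 1) := hp.chain (b := 1) (.inr ⟨rfl, rfl⟩) (by omega) hS (α := 0)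
    fun i hi => by
      have := hp.lo_le (s := 5) (by omega) (by omega) (by omega) hi
      rw [lo_five_one] at this
      rwa [b51, add_zero]
  simp only [wt₁, ↓reduceIte, b20] at first
  simp only [wt₂, one_ne_zero, ↓reduceIte, b51] at second
  rcases Nat.eq_zero_or_pos (slack I 0) with h0 | h0 <;>
    rcases Nat.eq_zero_or_pos (slack I 1) with h1 | h1
  · exact ⟨1, 1, by rw [sum_wt_of_slack_eq_zero h0, sum_wt_of_slack_eq_zero h1]⟩
  · obtain ⟨ρ, σ, -, -, j, hj, h⟩ := second h1
    refine ⟨1, ρ.trans σ.symm, ?_⟩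
    have h2 := hp.le_hi (s := 7) (by omega) (by omega) (by omega) hj
    rw [hi_seven_one h1, h0, Nat.zero_min] at h2
    rw [sum_wt_of_slack_eq_zero h0, eq_comm, ← Nat.le_zero]
    zify
    push_cast at h h2
    simp only [Equiv.trans_apply]
    linarith
  · obtain ⟨ρ, σ, -, -, j, hj, h⟩ := first h0
    refine ⟨ρ.trans σ.symm, 1, ?_⟩
    have h2 := hp.le_hi (s := 4) (by omega) (by omega) (by omega) hj
    rw [hi_four_zero h0, h1, Nat.min_zero] at h2
    rw [sum_wt_of_slack_eq_zero h1, ← Nat.le_zero]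
    zify
    push_cast at h h2
    simp only [Equiv.trans_apply]
    linarith
  · obtain ⟨ρ₀, σ₀, hρ₀, hσ₀, j₀, hj₀, hu₀⟩ := first h0
    obtain ⟨ρ₁, σ₁, hρ₁, hσ₁, j₁, hj₁, hu₁⟩ := second h1
    have e4 : ((min (slack I 0) (slack I 1) : ℕ) : ℤ) ≤ slack I 0 := by
      exact_mod_cast min_le_left _ _
    have e5 : ((min (slack I 0) (slack I 1) : ℕ) : ℤ) ≤ slack I 1 := by
      exact_mod_cast min_le_right _ _
    have e6 : (0 : ℤ) < slack I 0 := by exact_mod_cast h0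
    have e7 : (0 : ℤ) < slack I 1 := by exact_mod_cast h1
    obtain ⟨ρ₁', σ₁', hρ₁', hσ₁', j₁', hj₁', hu₁'⟩ := hp.chain (b := 1)
      (α := ∑ i : Fin (cnt I 0), (wt I 0 i (σ₀.symm (ρ₀ i)) : ℤ))
      (.inl ⟨rfl, rfl⟩) (by omega) h1 fun i hi => by
        have e1 := hp.lo_le (s := 2) (by omega) (by omega) (by omega) hi
        have e2 := hp.le_hi (s := 4) (by omega) (by omega) (by omega) hj₀
        have e3 := hp.link_le (s := 4) (t := 2) (by omega) (by omega) (by omega) (by omega)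
          (by omega) (by omega) (by omega) hj₀ hi
        rw [hi_four_zero h0] at e2
        rw [lo_two_one] at e1
        rw [show link I 4 2 0 = 2 * slack I 0 by simp [link]] at e3
        rw [b21]
        push_cast at e1 e3 hu₀ ⊢
        rw [abs_of_nonpos (by linarith)] at e3
        linarith
    obtain ⟨ρ₀', σ₀', hρ₀', hσ₀', j₀', hj₀', hu₀'⟩ := hp.chain (b := 0)
      (α := ∑ i : Fin (cnt I 1), (wt I 1 i (σ₁.symm (ρ₁ i)) : ℤ))
      (.inr ⟨rfl, rfl⟩) (by omega) h0 fun i hi => by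
        have e1 := hp.lo_le (s := 5) (by omega) (by omega) (by omega) hi
        have e2 := hp.le_hi (s := 7) (by omega) (by omega) (by omega) hj₁
        have e3 := hp.link_le (s := 7) (t := 5) (by omega) (by omega) (by omega) (by omega)
          (by omega) (by omega) (by omega) hj₁ hi
        rw [hi_seven_one h1] at e2
        rw [lo_five_zero] at e1
        rw [show link I 7 5 1 = 2 * slack I 1 by simp [link]] at e3
        rw [b50]
        push_cast at e1 e3 hu₁ ⊢
        rw [abs_of_nonpos (by linarith)] at e3
        linarith
    obtain rfl := hp.ranks_eq (.inl rfl) (by omega) h0 hρ₀ hρ₀'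
    obtain rfl := hp.ranks_eq (.inr rfl) (by omega) h0 hσ₀ hσ₀'
    obtain rfl := hp.ranks_eq (.inl rfl) (by omega) h1 hρ₁' hρ₁
    obtain rfl := hp.ranks_eq (.inr rfl) (by omega) h1 hσ₁' hσ₁
    refine ⟨ρ₀.trans σ₀.symm, ρ₁'.trans σ₁'.symm, ?_⟩
    have f1 := hp.le_hi (s := 4) (by omega) (by omega) (by omega) hj₁'
    have f2 := hp.le_hi (s := 7) (by omega) (by omega) (by omega) hj₀'
    have f3 := sum_complement I 0 (ρ₀.trans σ₀.symm)
    have f4 := sum_complement I 1 (ρ₁'.trans σ₁'.symm)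
    simp only [wt₁, wt₂, one_ne_zero, ↓reduceIte, b21, b50] at hu₀' hu₁'
    rw [hi_four_one h1] at f1
    rw [hi_seven_zero h0] at f2
    simp only [Equiv.trans_apply] at f3 f4 ⊢
    rw [f3] at hu₀'
    rw [f4] at hu₁'
    push_cast at hu₀' hu₁'
    zify
    linarith

end MatchingReduction

/-! ## Completeness -/

namespace MatchingReduction

open Equiv

section spacing

variable {F : ℕ → ℕ} {S B q r : ℕ}

theorem six_mul_add_le (hF : Monotone F) {c d : ℕ} (h : q < r) (hcd : q + c ≤ r + d) :
    6 * S * q + F (q + c) + 6 * S ≤ 6 * S * r + F (r + d) := by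
  have h1 : 6 * S * (q + 1) ≤ 6 * S * r := Nat.mul_le_mul_left _ h
  have h2 := hF hcd
  linarith

theorem same_spacing (hF : Monotone F) (h : q ≠ r) (c : ℕ) :
    6 * (S : ℤ) ≤ |((B + 6 * S * q + F (q + c) : ℕ) : ℤ) - (B + 6 * S * r + F (r + c) : ℕ)| := by
  rcases h.lt_or_gt with h | h <;>
    have h1 := six_mul_add_le (S := S) hF h (c := c) (d := c) (by omega) <;> zify at h1 <;> push_cast
  · exact le_abs.2 (.inr (by linarith))
  · exact le_abs.2 (.inl (by linarith))

theorem first_second_spacing (hF : Monotone F) {A : ℕ} (hA : A ≤ S) (h : q = r → F q + A ≤ F (q + 1)) :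
    2 * (S : ℤ) + A ≤
      |((B + 6 * S * q + F q : ℕ) : ℤ) - (B + 2 * S + 6 * S * r + F (r + 1) : ℕ)| := by
  rcases lt_trichotomy q r with h' | rfl | h'
  · have h1 := six_mul_add_le (S := S) hF h' (c := 0) (d := 1) (by omega)
    zify at h1 hA
    push_cast
    refine le_abs.2 (.inr ?_)
    simp only [add_zero] at h1
    linarith
  · have h1 := h rfl
    zify at h1 hA
    push_cast
    exact le_abs.2 (.inr (by linarith))
  · have h1 := six_mul_add_le (S := S) hF h' (c := 1) (d := 0) (by omega)
    zify at h1 hA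
    push_cast
    refine le_abs.2 (.inl ?_)
    simp only [add_zero] at h1
    linarith

theorem second_separator_spacing (hF : Monotone F) :
    2 * (S : ℤ) ≤
      |((B + 2 * S + 6 * S * q + F (q + 1) : ℕ) : ℤ) - (B + 4 * S + 6 * S * r + F (r + 1) : ℕ)| := by
  rcases lt_trichotomy q r with h' | rfl | h'
  · have h1 := six_mul_add_le (S := S) hF h' (c := 1) (d := 1) (by omega)
    zify at h1
    push_cast
    exact le_abs.2 (.inr (by linarith))
  · push_cast
    exact le_abs.2 (.inr (by linarith))
  · have h1 := six_mul_add_le (S := S) hF h' (c := 1) (d := 1) (by omega)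
    zify at h1
    push_cast
    exact le_abs.2 (.inl (by linarith))

theorem separator_first_spacing (hF : Monotone F) :
    2 * (S : ℤ) ≤
      |((B + 4 * S + 6 * S * q + F (q + 1) : ℕ) : ℤ) - (B + 6 * S * r + F r : ℕ)| := by
  rcases lt_or_ge q r with h' | h'
  · have h1 := six_mul_add_le (S := S) hF h' (c := 1) (d := 0) (by omega)
    simp only [add_zero] at h1
    zify at h1
    push_cast
    exact le_abs.2 (.inr (by linarith))
  · have h1 : 6 * S * r ≤ 6 * S * q := Nat.mul_le_mul_left _ h'
    have h2 : F r ≤ F (q + 1) := hF (by omega)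
    zify at h1 h2
    push_cast
    exact le_abs.2 (.inl (by linarith))

end spacing

/-- The place of a vertex on the line: vertices of the second kinds are ordered by `τ`, and
`F₁`, `F₂` are the accumulated weights in the two halves. -/
def place (I : Mats) (τ F₁ F₂ : ℕ → ℕ → ℕ) (v : Vtx) : ℕ :=
  if v.1 = 0 then 0 else if v.1 = 1 then total I else
    let q := if v.1 = 3 ∨ v.1 = 6 then τ v.2.1 v.2.2 else v.2.2
    lo I v.1 v.2.1 + 6 * slack I v.2.1 * q +
      (if v.1 ≤ 4 then F₁ else F₂) v.2.1 (if v.1 = 2 ∨ v.1 = 5 then q else q + 1)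

/-- Orderings and accumulated weights that describe matchings of equal weight. -/
structure Guide (I : Mats) (π τ F₁ F₂ : ℕ → ℕ → ℕ) : Prop where
  lt : ∀ {b j}, b < 2 → j < cnt I b → τ b j < cnt I b
  apply : ∀ {b j}, b < 2 → j < cnt I b → π b (τ b j) = j
  mono₁ : ∀ b, Monotone (F₁ b)
  mono₂ : ∀ b, Monotone (F₂ b)
  step₁ : ∀ b q, F₁ b q + wt₁ I b q (π b q) ≤ F₁ b (q + 1)
  step₂ : ∀ b q, F₂ b q + wt₂ I b q (π b q) ≤ F₂ b (q + 1)
  le₁ : ∀ {b}, b < 2 → F₁ b (cnt I b) ≤ room I 4 b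
  le₂ : ∀ {b}, b < 2 → F₂ b (cnt I b) ≤ room I 7 b
  link₁ : F₁ 0 (cnt I 0) ≤ F₁ 1 0
  link₂ : F₂ 1 (cnt I 1) ≤ F₂ 0 0

section places

variable {I : Mats} {π τ F₁ F₂ : ℕ → ℕ → ℕ}

theorem place_two (b i : ℕ) :
    place I τ F₁ F₂ (2, b, i) = base I 2 b + 6 * slack I b * i + F₁ b i := by
  simp [place, lo, shift]

theorem place_three (b i : ℕ) : place I τ F₁ F₂ (3, b, i) =
    base I 2 b + 2 * slack I b + 6 * slack I b * τ b i + F₁ b (τ b i + 1) := by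
  simp [place, lo, shift, base]

theorem place_four (b i : ℕ) : place I τ F₁ F₂ (4, b, i) =
    base I 2 b + 4 * slack I b + 6 * slack I b * i + F₁ b (i + 1) := by
  simp [place, lo, shift, base]

theorem place_five (b i : ℕ) :
    place I τ F₁ F₂ (5, b, i) = base I 5 b + 6 * slack I b * i + F₂ b i := by
  simp [place, lo, shift]

theorem place_six (b i : ℕ) : place I τ F₁ F₂ (6, b, i) =
    base I 5 b + 2 * slack I b + 6 * slack I b * τ b i + F₂ b (τ b i + 1) := by
  simp [place, lo, shift, base]

theorem place_seven (b i : ℕ) : place I τ F₁ F₂ (7, b, i) =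
    base I 5 b + 4 * slack I b + 6 * slack I b * i + F₂ b (i + 1) := by
  simp [place, lo, shift, base]

theorem wmax_le_slack {b i : ℕ} (hi : i < cnt I b) : wmax I b ≤ slack I b :=
  Nat.le_mul_of_pos_left _ (Nat.zero_lt_of_lt hi)

theorem slack_le_scale {b i : ℕ} (hi : i < cnt I b) : slack I b ≤ scale I b :=
  Nat.le_mul_of_pos_left _ (Nat.zero_lt_of_lt hi)

theorem wt₁_le (b i j : ℕ) : wt₁ I b i j ≤ wmax I b := by
  unfold wt₁
  split_ifs
  · exact wt_le_wmax I b i j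
  · exact Nat.sub_le _ _

theorem wt₂_le (b i j : ℕ) : wt₂ I b i j ≤ wmax I b := by
  unfold wt₂
  split_ifs
  · exact Nat.sub_le _ _
  · exact wt_le_wmax I b i j

theorem hi_le_total {s b i : ℕ} (hb : b < 2) (h : i < cnt I b) : hi I s b ≤ total I := by
  have h1 := slack_le_scale h
  have h2 := room_le I s hb
  have h3 : base I s b + 6 * scale I b ≤ total I := by
    unfold base total
    interval_cases b <;> simp <;> split_ifs <;> omega
  have h4 : shift I s b ≤ 4 * slack I b := by unfold shift; split_ifs <;> omega
  have h5 : shift I s b + room I s b ≤ 5 * slack I b := by omega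
  unfold hi lo
  split_ifs <;> omega

theorem lo_le_place (s b i : ℕ) : lo I s b ≤ place I τ F₁ F₂ (s, b, i) := by
  unfold place
  by_cases h0 : s = 0
  · simp [lo, h0]
  by_cases h1 : s = 1
  · simp [lo, h1]
  simp only [h0, h1, if_false]
  omega

namespace Guide

variable (g : Guide I π τ F₁ F₂)
include g

theorem eq_of_eq {b i j : ℕ} (hb : b < 2) (hi : i < cnt I b) (hj : j < cnt I b)
    (h : τ b i = τ b j) : i = j := by
  rw [← g.apply hb hi, h, g.apply hb hj]

theorem le_hi {s b i : ℕ} (hs : s < 8) (hb : b < 2) (hi' : i < cnt I b) :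
    place I τ F₁ F₂ (s, b, i) ≤ hi I s b := by
  have hq : ∀ q < cnt I b, 6 * slack I b * q ≤ 6 * scale I b - 6 * slack I b := fun q hq => by
    have : 6 * slack I b * (q + 1) ≤ 6 * slack I b * cnt I b := Nat.mul_le_mul_left _ hq
    rw [scale_eq]
    have h2 : 6 * slack I b * cnt I b = 6 * (cnt I b * slack I b) := by ring
    have h3 : 6 * slack I b * (q + 1) = 6 * slack I b * q + 6 * slack I b := by ring
    omega
  have hF₁ : ∀ q ≤ cnt I b, F₁ b q ≤ room I 4 b := fun q hq => (g.mono₁ b hq).trans (g.le₁ hb)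
  have hF₂ : ∀ q ≤ cnt I b, F₂ b q ≤ room I 7 b := fun q hq => (g.mono₂ b hq).trans (g.le₂ hb)
  have r4 := room_le I 4 hb
  have r7 := room_le I 7 hb
  have a1 := hq i hi'
  have a2 := hq _ (g.lt hb hi')
  have a3 := hF₁ i hi'.le
  have a4 := hF₁ (i + 1) hi'
  have a5 := hF₁ (τ b i + 1) (g.lt hb hi')
  have a6 := hF₂ i hi'.le
  have a7 := hF₂ (i + 1) hi'
  have a8 := hF₂ (τ b i + 1) (g.lt hb hi')
  have e (t : ℕ) (h0 : t ≠ 0) (h1 : t ≠ 1) : hi I t b =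
    base I t b + shift I t b + (6 * scale I b - 6 * slack I b) + room I t b := by
    simp [hi, lo, h0, h1]
  have r (t : ℕ) (h4 : t ≠ 4) (h7 : t ≠ 7) : room I t b = slack I b := by
    simp [room, h4, h7]
  interval_cases s
  · simp [place, hi]
  · simp [place, hi]
  · rw [place_two, e 2 (by omega) (by omega), r 2 (by omega) (by omega)]; omega
  · rw [place_three, e 3 (by omega) (by omega), r 3 (by omega) (by omega),
      show base I 3 b = base I 2 b by simp [base], show shift I 3 b = 2 * slack I b by simp [shift]]
    omega
  · rw [place_four, e 4 (by omega) (by omega), show base I 4 b = base I 2 b by simp [base],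
      show shift I 4 b = 4 * slack I b by simp [shift]]
    omega
  · rw [place_five, e 5 (by omega) (by omega), r 5 (by omega) (by omega)]; omega
  · rw [place_six, e 6 (by omega) (by omega), r 6 (by omega) (by omega),
      show base I 6 b = base I 5 b by simp [base], show shift I 6 b = 2 * slack I b by simp [shift]]
    omega
  · rw [place_seven, e 7 (by omega) (by omega), show base I 7 b = base I 5 b by simp [base],
      show shift I 7 b = 4 * slack I b by simp [shift]]
    omega

theorem le_total {s b i : ℕ} (hs : s < 8) (hb : b < 2) (h : i < cnt I b) :
    place I τ F₁ F₂ (s, b, i) ≤ total I :=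
  (g.le_hi hs hb h).trans (hi_le_total hb h)

theorem tie_le {s t b i : ℕ} (h : s = 2 ∧ t = 5 ∨ s = 3 ∧ t = 6) (hb : b < 2) (hi : i < cnt I b) :
    ((lo I t b - lo I s b - slack I b : ℕ) : ℤ) ≤
      |(place I τ F₁ F₂ (s, b, i) : ℤ) - place I τ F₁ F₂ (t, b, i)| := by
  have h0 : lo I t b + place I τ F₁ F₂ (s, b, i) ≤
      lo I s b + place I τ F₁ F₂ (t, b, i) + slack I b := by
    have r4 := room_le I 4 hb
    have h1 := (g.mono₁ b hi.le).trans (g.le₁ hb)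
    have h2 : F₁ b (τ b i + 1) ≤ _ := (g.mono₁ b (g.lt hb hi)).trans (g.le₁ hb)
    rcases h with ⟨rfl, rfl⟩ | ⟨rfl, rfl⟩
    · rw [place_two, place_five, show lo I 2 b = base I 2 b by simp [lo, shift],
        show lo I 5 b = base I 5 b by simp [lo, shift]]
      omega
    · rw [place_three, place_six, show lo I 3 b = base I 2 b + 2 * slack I b by simp [lo, shift, base],
        show lo I 6 b = base I 5 b + 2 * slack I b by simp [lo, shift, base]]
      omega
  rw [abs_sub_comm]
  rcases _root_.le_total (lo I s b + slack I b) (lo I t b) with h1 | h1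
  · refine le_trans ?_ (le_abs_self _)
    omega
  · rw [show lo I t b - lo I s b - slack I b = 0 by omega]
    exact abs_nonneg _

theorem gap_le {s t b i j : ℕ} (hs : s < 8) (hb : b < 2)
    (hi : i < cnt I b) (hj : j < cnt I b) (h : s = t → 2 ≤ s) : (gap I s t b i j : ℤ) ≤
      |(place I τ F₁ F₂ (s, b, i) : ℤ) - place I τ F₁ F₂ (t, b, j)| := by
  have h0 := abs_nonneg ((place I τ F₁ F₂ (s, b, i) : ℤ) - place I τ F₁ F₂ (t, b, j))
  have m₁ := g.mono₁ b
  have m₂ := g.mono₂ b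
  have w₁ : ∀ i' j', wt₁ I b i' j' ≤ slack I b := fun i' j' => (wt₁_le b i' j').trans (wmax_le_slack hi)
  have w₂ : ∀ i' j', wt₂ I b i' j' ≤ slack I b := fun i' j' => (wt₂_le b i' j').trans (wmax_le_slack hi)
  unfold gap
  split_ifs with h1 h2 h3 h4 h5 h6 h7 h8 h9 h10 h11 h12 h13 h14 h15 h16 h17 h18 <;>
    try exact h0
  · subst h1
    have h2' : τ b i ≠ τ b j := fun h' => h2 (g.eq_of_eq hb hi hj h')
    have := h rfl
    push_cast
    interval_cases s
    · rw [place_two, place_two]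
      exact same_spacing m₁ h2 0
    · simpa only [place_three] using same_spacing m₁ h2' 1
    · simpa only [place_four] using same_spacing m₁ h2 1
    · rw [place_five, place_five]
      exact same_spacing m₂ h2 0
    · simpa only [place_six] using same_spacing m₂ h2' 1
    · simpa only [place_seven] using same_spacing m₂ h2 1
  · subst_vars
    rw [place_two, place_three]
    push_cast
    exact_mod_cast first_second_spacing m₁ (w₁ i j) fun h' =>
      by simpa [h', g.apply hb hj] using g.step₁ b i
  · subst_vars
    exact g.tie_le (.inl ⟨rfl, rfl⟩) hb hi
  · subst_vars
    rw [place_three, place_four]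
    push_cast
    exact_mod_cast second_separator_spacing m₁
  · subst_vars
    exact g.tie_le (.inr ⟨rfl, rfl⟩) hb hi
  · subst_vars
    rw [place_four, place_two]
    push_cast
    exact_mod_cast separator_first_spacing m₁
  · subst_vars
    rw [place_five, place_six]
    push_cast
    exact_mod_cast first_second_spacing m₂ (w₂ i j) fun h' =>
      by simpa [h', g.apply hb hj] using g.step₂ b i
  · subst_vars
    rw [place_six, place_seven]
    push_cast
    exact_mod_cast second_separator_spacing m₂
  · subst_vars
    rw [place_seven, place_five]
    push_cast
    exact_mod_cast separator_first_spacing m₂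

theorem link_le {s t b b' i j : ℕ} (hb : b < 2) (hb' : b' < 2) (h : b ≠ b')
    (hi : i < cnt I b) : (link I s t b : ℤ) ≤
      |(place I τ F₁ F₂ (s, b, i) : ℤ) - place I τ F₁ F₂ (t, b', j)| := by
  have h0 := abs_nonneg ((place I τ F₁ F₂ (s, b, i) : ℤ) - place I τ F₁ F₂ (t, b', j))
  have h1 : 6 * slack I b * (i + 1) ≤ 6 * scale I b := by
    rw [scale_eq, mul_comm (cnt I b), ← mul_assoc]
    exact Nat.mul_le_mul_left _ hi
  have m₁ : F₁ b (i + 1) ≤ F₁ b (cnt I b) := g.mono₁ b hi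
  have m₂ : F₂ b (i + 1) ≤ F₂ b (cnt I b) := g.mono₂ b hi
  rw [mul_add_one] at h1
  unfold link
  split_ifs with hs ht hb0 hs ht hb0 <;> try exact h0
  · subst_vars
    obtain rfl : b' = 1 := by omega
    rw [place_four, place_two, show base I 2 0 = 0 by simp [base],
      show base I 2 1 = 6 * scale I 0 by simp [base], abs_sub_comm]
    refine le_trans ?_ (le_abs_self _)
    have h3 := g.mono₁ 1 (Nat.zero_le j)
    have h4 := g.link₁
    push_cast
    zify at *
    have : 0 ≤ 6 * (slack I 1 : ℤ) * j := by positivity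
    linarith
  · subst_vars
    obtain rfl : b = 1 := by omega
    obtain rfl : b' = 0 := by omega
    rw [place_seven, place_five, show base I 5 0 = 6 * scale I 0 + 12 * scale I 1 by simp [base],
      show base I 5 1 = 6 * scale I 0 + 6 * scale I 1 by simp [base], abs_sub_comm]
    refine le_trans ?_ (le_abs_self _)
    have h3 := g.mono₂ 0 (Nat.zero_le j)
    have h4 := g.link₂
    push_cast
    zify at *
    have : 0 ≤ 6 * (slack I 0 : ℤ) * j := by positivity
    linarith

theorem fits : Fits I fun v => place I τ F₁ F₂ v := by
  constructor
  · rintro ⟨s, b, i⟩ hu ⟨t, b', j⟩ hv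
    obtain ⟨hs, hb, hi⟩ := mem_verts.1 hu
    obtain ⟨ht, hb', hj⟩ := mem_verts.1 hv
    unfold edge
    dsimp only
    split_ifs with h1 h2 h3
    · subst h1
      rw [show place I τ F₁ F₂ (0, b, i) = 0 by simp [place], abs_sub_comm]
      refine le_trans ?_ (le_abs_self _)
      have := lo_le_place (I := I) (τ := τ) (F₁ := F₁) (F₂ := F₂) t b' j
      push_cast
      omega
    · subst h2
      rw [show place I τ F₁ F₂ (1, b', j) = total I by simp [place], abs_sub_comm]
      refine le_trans ?_ (le_abs_self _)
      have h4 := g.le_hi hs hb hi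
      have h5 := hi_le_total (s := s) hb hi
      omega
    · subst h3
      exact g.gap_le hs hb hi hj (by omega)
    · exact g.link_le hb hb' h3 hi
  · rintro ⟨s, b, i⟩ hu ⟨t, b', j⟩ hv
    obtain ⟨hs, hb, hi⟩ := mem_verts.1 hu
    have := g.le_total hs hb hi
    omega

end Guide

end places

/-- A permutation of `Fin n` and its inverse as functions on natural numbers. -/
theorem exists_nat_perm {n : ℕ} (π : Perm (Fin n)) : ∃ f f' : ℕ → ℕ,
    (∀ j < n, f' j < n) ∧ (∀ j < n, f (f' j) = j) ∧ ∀ i : Fin n, f i = π i :=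
  ⟨fun i => if h : i < n then π ⟨i, h⟩ else i, fun j => if h : j < n then π.symm ⟨j, h⟩ else j,
    fun j h => by simp [h], fun j h => by simp [h], fun i => by simp⟩

theorem exists_fits {I : Mats} (π₀ : Perm (Fin (cnt I 0))) (π₁ : Perm (Fin (cnt I 1)))
    (h : ∑ i : Fin (cnt I 0), wt I 0 i (π₀ i) = ∑ i : Fin (cnt I 1), wt I 1 i (π₁ i)) :
    ∃ p, Fits I p := by
  obtain ⟨f₀, f₀', hlt₀, happ₀, he₀⟩ := exists_nat_perm π₀
  obtain ⟨f₁, f₁', hlt₁, happ₁, he₁⟩ := exists_nat_perm π₁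
  set W := ∑ i : Fin (cnt I 0), wt I 0 i (π₀ i) with hW
  have e₀ : ∑ q ∈ Finset.range (cnt I 0), wt I 0 q (f₀ q) = W := by
    rw [Finset.sum_range, hW]
    simp only [he₀]
  have e₁ : ∑ q ∈ Finset.range (cnt I 1), wt I 1 q (f₁ q) = W := by
    rw [Finset.sum_range, h]
    simp only [he₁]
  have c₀ : W + ∑ q ∈ Finset.range (cnt I 0), (wmax I 0 - wt I 0 q (f₀ q)) = slack I 0 := by
    rw [← e₀, ← Finset.sum_add_distrib, slack_eq]
    simp [Nat.add_sub_cancel' (wt_le_wmax _ _ _ _)]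
  have c₁ : W + ∑ q ∈ Finset.range (cnt I 1), (wmax I 1 - wt I 1 q (f₁ q)) = slack I 1 := by
    rw [← e₁, ← Finset.sum_add_distrib, slack_eq]
    simp [Nat.add_sub_cancel' (wt_le_wmax _ _ _ _)]
  have hmono (c : ℕ) (A : ℕ → ℕ) : Monotone fun n => c + ∑ q ∈ Finset.range n, A q :=
    monotone_nat_of_le_succ fun n => by rw [Finset.sum_range_succ]; omega
  let π : ℕ → ℕ → ℕ := fun b => if b = 0 then f₀ else f₁
  refine ⟨_, Guide.fits (π := π) (τ := fun b => if b = 0 then f₀' else f₁')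
    (F₁ := fun b n => (if b = 0 then 0 else W) + ∑ q ∈ Finset.range n, wt₁ I b q (π b q))
    (F₂ := fun b n => (if b = 0 then W else 0) + ∑ q ∈ Finset.range n, wt₂ I b q (π b q))
    ⟨?_, ?_, fun b => hmono _ _, fun b => hmono _ _,
      fun b q => by rw [Finset.sum_range_succ, add_assoc],
      fun b q => by rw [Finset.sum_range_succ, add_assoc], ?_, ?_, ?_, ?_⟩⟩
  · intro b j hb hj
    interval_cases b
    · simpa using hlt₀ j hj
    · simpa using hlt₁ j hj
  · intro b j hb hj
    interval_cases b
    · simpa [π] using happ₀ j hj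
    · simpa [π] using happ₁ j hj
  · intro b hb
    interval_cases b
    · simp [π, wt₁, room, e₀]; omega
    · simp [π, wt₁, room, c₁]
  · intro b hb
    interval_cases b
    · simp [π, wt₂, room, c₀]
    · simp [π, wt₂, room, e₁]; omega
  · simp [π, wt₁, e₀]
  · simp [π, wt₂, e₁]

end MatchingReduction

/-! ## The reduction is correct -/

namespace MatchingReduction

open Equiv

theorem exists_fits_iff (I : Mats) : (∃ p, Fits I p) ↔
    ∃ (π₀ : Perm (Fin (cnt I 0))) (π₁ : Perm (Fin (cnt I 1))),
      ∑ i : Fin (cnt I 0), wt I 0 i (π₀ i) = ∑ i : Fin (cnt I 1), wt I 1 i (π₁ i) := by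
  constructor
  · rintro ⟨p, hp⟩
    obtain ⟨p, hp⟩ := hp.exists_normal
    exact hp.exists_perm
  · rintro ⟨π₀, π₁, h⟩
    exact exists_fits π₀ π₁ h

theorem cnt_mats_zero (J : CommonMatchingWeight) : cnt (mats J) 0 = J.G₁.k := by
  simp [cnt, mat, mats]

theorem cnt_mats_one (J : CommonMatchingWeight) : cnt (mats J) 1 = J.G₂.k := by
  simp [cnt, mat, mats]

theorem wt_mats_zero (J : CommonMatchingWeight) (i j : Fin J.G₁.k) :
    wt (mats J) 0 i j = J.G₁.w i j := by
  simp [wt, mat, mats]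

theorem wt_mats_one (J : CommonMatchingWeight) (i j : Fin J.G₂.k) :
    wt (mats J) 1 i j = J.G₂.w i j := by
  simp [wt, mat, mats]

theorem exists_perm_sum_congr {n m n' m' : ℕ} (h : n = m) (h' : n' = m') {A A' : ℕ → ℕ → ℕ}
    {w : Fin m → Fin m → ℕ} {w' : Fin m' → Fin m' → ℕ} (hA : ∀ i j : Fin m, A i j = w i j)
    (hA' : ∀ i j : Fin m', A' i j = w' i j) :
    (∃ (π : Perm (Fin n)) (π' : Perm (Fin n')),
      ∑ i : Fin n, A i (π i) = ∑ i : Fin n', A' i (π' i)) ↔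
    ∃ (π : Perm (Fin m)) (π' : Perm (Fin m')), ∑ i, w i (π i) = ∑ i, w' i (π' i) := by
  subst h h'
  simp [hA, hA']

theorem isYes_iff (J : CommonMatchingWeight) : (toChannelAssignment J).IsYes ↔ J.IsYes := by
  rw [isYes_toChannelAssignment_iff, exists_fits_iff, CommonMatchingWeight.isYes_iff]
  exact exists_perm_sum_congr (cnt_mats_zero J) (cnt_mats_one J) (wt_mats_zero J) (wt_mats_one J)

theorem length_verts (I : Mats) : (verts I).length = 8 * (cnt I 0 + cnt I 1) := by
  simp [verts, cnt, mat]
  ring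

theorem lo_le_total (I : Mats) (s : ℕ) {b i : ℕ} (hb : b < 2) (h : i < cnt I b) :
    lo I s b ≤ total I := by
  refine le_trans ?_ (hi_le_total (s := s) hb h)
  by_cases h0 : s = 0
  · simp [lo, h0]
  by_cases h1 : s = 1
  · simp [lo, hi, h1]
  simp only [hi, h0, h1, if_false]
  omega

theorem slack_le_total {I : Mats} {b i : ℕ} (hb : b < 2) (h : i < cnt I b) :
    6 * slack I b ≤ total I := by
  have h1 := slack_le_scale h
  unfold total
  interval_cases b <;> omega

theorem gap_le_total {I : Mats} {b i j : ℕ} (s t : ℕ) (hb : b < 2) (h : i < cnt I b) :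
    gap I s t b i j ≤ total I := by
  have h1 := slack_le_total hb h
  have h2 := lo_le_total I t hb h
  have h3 := (wt₁_le b i j).trans (wmax_le_slack h)
  have h4 := (wt₂_le b i j).trans (wmax_le_slack h)
  unfold gap
  split_ifs <;> omega

theorem edge_le_total {I : Mats} {u v : Vtx} (hu : u ∈ verts I) (hv : v ∈ verts I) :
    edge I u v ≤ total I := by
  obtain ⟨s, b, i⟩ := u
  obtain ⟨t, b', j⟩ := v
  obtain ⟨-, hb, hi⟩ := mem_verts.1 hu
  obtain ⟨-, hb', hj⟩ := mem_verts.1 hv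
  unfold edge
  split_ifs
  · exact lo_le_total I t hb' hj
  · exact Nat.sub_le _ _
  · exact gap_le_total s t hb hi
  · have h1 := slack_le_total hb hi
    unfold link
    dsimp only
    interval_cases b <;> simp <;> split_ifs <;> omega

theorem dist_le_total {I : Mats} {u v : Vtx} (hu : u ∈ verts I) (hv : v ∈ verts I) :
    dist I u v ≤ total I :=
  max_le (edge_le_total hu hv) (edge_le_total hv hu)

theorem foldl_max_le {l : List ℕ} {k m : ℕ} (hk : k ≤ m) (h : ∀ x ∈ l, x ≤ m) :
    l.foldl Max.max k ≤ m := by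
  induction l generalizing k with
  | nil => exact hk
  | cons y l ih =>
    exact ih (max_le hk (h y List.mem_cons_self)) fun x hx => h x (List.mem_cons_of_mem _ hx)

theorem wmax_le {I : Mats} {b m : ℕ} (h : ∀ r ∈ mat I b, ∀ x ∈ r, x ≤ m) : wmax I b ≤ m :=
  foldl_max_le (Nat.zero_le _) fun x hx => by
    obtain ⟨r, hr, rfl⟩ := List.mem_map.1 hx
    exact foldl_max_le (Nat.zero_le _) (h r hr)

theorem wmax_mats_zero_le {J : CommonMatchingWeight} {m : ℕ} (h : J.G₁.BoundedBy m) :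
    wmax (mats J) 0 ≤ m :=
  wmax_le (by simpa [mat, mats, List.forall_mem_ofFn_iff, WeightedBipartite.BoundedBy] using h)

theorem wmax_mats_one_le {J : CommonMatchingWeight} {m : ℕ} (h : J.G₂.BoundedBy m) :
    wmax (mats J) 1 ≤ m :=
  wmax_le (by simpa [mat, mats, List.forall_mem_ofFn_iff, WeightedBipartite.BoundedBy] using h)

theorem scale_le {I : Mats} {b m : ℕ} (h : wmax I b ≤ m) : scale I b ≤ (2 * cnt I b) ^ 2 * m := by
  calc scale I b = cnt I b ^ 2 * wmax I b := by rw [scale_eq, slack_eq]; ring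
    _ ≤ (2 * cnt I b) ^ 2 * m := by gcongr; omega

end MatchingReduction

theorem WeightedBipartite.numVertices_eq (G : WeightedBipartite) : G.numVertices = 2 * G.k := by
  simp [numVertices, two_mul]

open MatchingReduction in
theorem mainTheorem5 :
    ∃ f : CommonMatchingWeight → ChannelAssignment,
      -- the reduction runs in polynomial time on a Turing machine
      Nonempty (Turing.TM2ComputableInPolyTime
        CommonMatchingWeight.encode ChannelAssignment.encode f) ∧
      -- it is a reduction
      (∀ I : CommonMatchingWeight, (f I).IsYes ↔ I.IsYes) ∧
      -- with linearly many vertices and small weights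
      ∃ C : ℕ, ∀ I : CommonMatchingWeight,
        (f I).n ≤ C * (I.G₁.numVertices + I.G₂.numVertices) ∧
        ∀ m₁ m₂ : ℕ, I.G₁.BoundedBy m₁ → I.G₂.BoundedBy m₂ →
          ∀ x y, (f I).d x y ≤
            C * (I.G₁.numVertices ^ 2 * m₁ + I.G₂.numVertices ^ 2 * m₂) := by
  refine ⟨toChannelAssignment, polyTime, isYes_iff, 12, fun J => ⟨?_, fun m₁ m₂ h₁ h₂ x y => ?_⟩⟩
  · change (verts (mats J)).length ≤ _
    rw [length_verts, cnt_mats_zero, cnt_mats_one, WeightedBipartite.numVertices_eq,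
      WeightedBipartite.numVertices_eq]
    omega
  · refine (dist_le_total (List.getElem_mem _) (List.getElem_mem _)).trans ?_
    rw [WeightedBipartite.numVertices_eq, WeightedBipartite.numVertices_eq, ← cnt_mats_zero,
      ← cnt_mats_one]
    exact Nat.mul_le_mul_left _
      (add_le_add (scale_le (wmax_mats_zero_le h₁)) (scale_le (wmax_mats_one_le h₂)))
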